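/- Let $n\ge 1$. Subgroups of $\mathrm{PGL}_{2n+2}(\mathbb C)$ act on $\mathbb P^{2n+1}=\mathbb P(\mathbb C^{2n+2})$, and an $n$-plane is an $n$-dimensional projective linear subspace of $\mathbb P^{2n+1}$. Put $N=\binom{2n+2}{n+1}-1$. For an $n$-plane $\ell$, let $\hat\ell\in\mathbb P^N=\mathbb P(\bigwedge^{n+1}\mathbb C^{2n+2})$ be the point given by its Plücker coordinates, and let $\rho:\mathrm{PGL}_{2n+2}(\mathbb C)\to\mathrm{PGL}_{N+1}(\mathbb C)$, $\sigma\mapsto\hat\sigma$, be the homomorphism induced by $A\mapsto\bigwedge^{n+1}A$, written in the standard basis $e_I$ (the matrix of $(n+1)\times(n+1)$ minors of $A$). For a matrix $A=(a_{jk})$ put $|A|=\max_{j,k}|a_{jk}|$. Call a sequence $(\sigma_\nu)$ of pairwise distinct elements of $\mathrm{PGL}_{M}(\mathbb C)$ convergent-type if representatives $\tilde\sigma_\nu\in \mathrm{GL}_M(\mathbb C)$ with $|\tilde\sigma_\nu|=1$ can be chosen that converge to a matrix $\tilde\sigma$; its limit image is the projective subspace defined by the image of $\tilde\sigma$ (it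 does not depend on the choice). A sequence $(\sigma_\nu)$ in a subgroup $\Gamma\subset\mathrm{PGL}_{2n+2}(\mathbb C)$ is normal if both $(\sigma_\nu)$ and $(\hat\sigma_\nu)$ are convergent-type; denote by $I(\hat\sigma)\subset\mathbb P^N$ the limit image of $(\hat\sigma_\nu)$. An $n$-plane $\ell$ is a limit $n$-plane of $\Gamma$ if $\hat\ell\in I(\hat\sigma)$ for some normal sequence $(\sigma_\nu)$ in $\Gamma$. The limit set $\Lambda(\Gamma)\subset\mathbb P^{2n+1}$ is the union of all limit $n$-planes of $\Gamma$, and $\Omega(\Gamma)=\mathbb P^{2n+1}\setminus\Lambda(\Gamma)$. The group $\Gamma$ is of type $\mathbf L$ if it is a discrete subgroup of $\mathrm{PGL}_{2n+2}(\mathbb C)$ and $\Omega(\Gamma)$ contains a domain (a non-empty connected open subset of $\mathbb P^{2n+1}$) which contains an $n$-plane. **Theorem.** If $\Gamma\subset\mathrm{PGL}_{2n+2}(\mathbb C)$ is of type $\mathbf L$, then $\Lambda(\Gamma)$ is a closed and nowhere dense subset of $\mathbb P^{2n+1}$, and it is $\Gamma$-invariant: $\gamma(\Lambda(\Gamma))=\Lambda(\Gamma)$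 for every $\gamma\in\Gamma$. -/

import Mathlib

open Filter Topology Matrix Module
open scoped LinearAlgebra.Projectivization MatrixGroups NNReal

namespace TypeL

/-! ### Topologies -/

/-- The quotient topology on `PGL`, coming from the usual topology on `GL`. -/
noncomputable instance instTopologicalSpacePGL (ι : Type*) [Fintype ι] [DecidableEq ι] :
    TopologicalSpace PGL(ι, ℂ) :=
  TopologicalSpace.coinduced (Matrix.ProjGenLinGroup.mk : GL ι ℂ → PGL(ι, ℂ)) inferInstance

/-- The quotient topology on the projective space of a finite dimensional coordinate space. -/
noncomputable instance instTopologicalSpaceProj (ι : Type*) [Fintype ι] : TopologicalSpace (ℙ ℂ (ι → ℂ)) :=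
  TopologicalSpace.coinduced
    (Projectivization.mk' ℂ : {v : ι → ℂ // v ≠ 0} → ℙ ℂ (ι → ℂ)) inferInstance

/-! ### Multi-indices, compound matrices, and the representation `ρ` -/

/-- Multi-indices `i_1 < ⋯ < i_k` in `{0, …, m - 1}`, as subsets of cardinality `k`. -/
abbrev MultiIndex (m k : ℕ) : Type := Set.powersetCard (Fin m) k

noncomputable instance instDecidableEqMultiIndex (m k : ℕ) : DecidableEq (MultiIndex m k) :=
  Classical.decEq _

/-- The increasing enumeration `i_1 < ⋯ < i_k` of a multi-index. -/
noncomputable def enum {m k : ℕ} (I : MultiIndex m k) : Fin k ↪o Fin m :=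
  Set.powersetCard.ofFinEmbEquiv.symm I

/-- The matrix of `k × k` minors of `A`: its entry in row `K` and column `J` is the minor of `A`
with rows `K` and columns `J`. It is the matrix of `⋀ᵏ A` in the basis `e_I`. -/
noncomputable def compound {m : ℕ} (k : ℕ) (A : Matrix (Fin m) (Fin m) ℂ) :
    Matrix (MultiIndex m k) (MultiIndex m k) ℂ :=
  Matrix.of fun K J => (A.submatrix (enum K) (enum J)).det

theorem compound_eq_toMatrix {m : ℕ} (k : ℕ) (A : Matrix (Fin m) (Fin m) ℂ) :
    compound k A = LinearMap.toMatrix ((Pi.basisFun ℂ (Fin m)).exteriorPower k)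
      ((Pi.basisFun ℂ (Fin m)).exteriorPower k) (exteriorPower.map k (Matrix.toLin' A)) := by
  ext K J
  rw [LinearMap.toMatrix_apply, exteriorPower.basis_apply, exteriorPower.map_apply_ιMulti_family,
    exteriorPower.basis_repr_apply, exteriorPower.ιMulti_family,
    exteriorPower.ιMultiDual_apply_ιMulti, compound, Matrix.of_apply, ← Matrix.det_transpose]
  congr 1
  ext i j
  simp [enum, Matrix.toLin'_apply]

/-- Passing to the matrix of minors is multiplicative. -/
noncomputable def compoundHom (m k : ℕ) :
    Matrix (Fin m) (Fin m) ℂ →* Matrix (MultiIndex m k) (MultiIndex m k) ℂ where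
  toFun := compound k
  map_one' := by
    rw [compound_eq_toMatrix, Matrix.toLin'_one, exteriorPower.map_id, LinearMap.toMatrix_id]
  map_mul' A B := by
    simp only [compound_eq_toMatrix]
    rw [Matrix.toLin'_mul, exteriorPower.map_comp,
      LinearMap.toMatrix_comp _ ((Pi.basisFun ℂ (Fin m)).exteriorPower k)]

theorem compound_smul_one {m : ℕ} (k : ℕ) (c : ℂ) :
    compound k (c • (1 : Matrix (Fin m) (Fin m) ℂ)) = c ^ k • 1 := by
  rw [← (compoundHom m k).map_one]
  ext K J
  simp [compound, compoundHom, Matrix.submatrix_smul]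

/-- The group representation `ρ : PGL_m(ℂ) → PGL_{N+1}(ℂ)`, `ρ(A) = Â`, where `N + 1 = C(m, k)`. -/
noncomputable def rho (m k : ℕ) : PGL(Fin m, ℂ) →* PGL(MultiIndex m k, ℂ) :=
  Matrix.ProjGenLinGroup.lift (Matrix.ProjGenLinGroup.mk.comp (Units.map (compoundHom m k))) <| by
    ext u
    have h : Units.map (compoundHom m k) (Matrix.GeneralLinearGroup.scalar (Fin m) u) =
        Matrix.GeneralLinearGroup.scalar (MultiIndex m k) (u ^ k) := by
      apply Units.ext
      change compound k _ = _
      have h1 := compound_smul_one (m := m) k (u : ℂ)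
      simpa only [Matrix.smul_one_eq_diagonal] using! h1
    simp [h]

/-! ### Normal sequences and limit images -/

section Normal

variable {ι : Type*} [Fintype ι] [DecidableEq ι]

/-- `|A| = max |a_{jk}|`. -/
noncomputable def maxAbs (A : Matrix ι ι ℂ) : ℝ :=
  ((Finset.univ.sup fun p : ι × ι => ‖A p.1 p.2‖₊ : ℝ≥0) : ℝ)

/-- `S` is the limit of a convergent sequence of representatives `T ν` of `σ ν` such that
`|T ν| = 1`. (Two such limits differ by a scalar factor of modulus one.) -/
def IsLimitMatrix (σ : ℕ → PGL(ι, ℂ)) (S : Matrix ι ι ℂ) : Prop :=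
  ∃ T : ℕ → GL ι ℂ,
    (∀ ν, Matrix.ProjGenLinGroup.mk (T ν) = σ ν ∧ maxAbs (T ν : Matrix ι ι ℂ) = 1) ∧
    Tendsto (fun ν => (T ν : Matrix ι ι ℂ)) atTop (𝓝 S)

/-- Normal sequences in `PGL`: distinct elements with a convergent sequence of representatives
of norm one. -/
def IsNormalSeq (σ : ℕ → PGL(ι, ℂ)) : Prop :=
  Function.Injective σ ∧ ∃ S, IsLimitMatrix σ S

/-- The limit image of a sequence: the projective linear subspace defined by the image of the limit
of representatives. It does not depend on the choice of that limit. -/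
def limitImage (σ : ℕ → PGL(ι, ℂ)) : Set (ℙ ℂ (ι → ℂ)) :=
  {p | ∃ S, IsLimitMatrix σ S ∧ p ∈ (LinearMap.range (Matrix.toLin' S)).projectivization}

end Normal

/-! ### `n`-planes and their Plücker coordinates -/

/-- The projective space `ℙ^{2n+1}`. -/
abbrev Proj (n : ℕ) : Type := ℙ ℂ (Fin (2 * n + 2) → ℂ)

/-- `n`-planes in `ℙ^{2n+1}`, that is, points of the Grassmannian `Gr(n+1, 2n+2)`. -/
def NPlane (n : ℕ) : Type :=
  {L : Submodule ℂ (Fin (2 * n + 2) → ℂ) // finrank ℂ L = n + 1}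

/-- The support `|ℓ|` of an `n`-plane: the set of its points. -/
def NPlane.support {n : ℕ} (ℓ : NPlane n) : Set (Proj n) :=
  {x | x ∈ ℓ.1.projectivization}

/-- Plücker coordinates of the `k`-vector `x_1 ∧ ⋯ ∧ x_k`. -/
noncomputable def pluckerVec {m k : ℕ} (x : Fin k → Fin m → ℂ) : MultiIndex m k → ℂ :=
  fun K => (Matrix.of fun i j => x j (enum K i)).det

theorem pluckerVec_eq_repr {m k : ℕ} (x : Fin k → Fin m → ℂ) (K : MultiIndex m k) :
    pluckerVec x K =
      ((Pi.basisFun ℂ (Fin m)).exteriorPower k).repr (exteriorPower.ιMulti ℂ k x) K := by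
  rw [exteriorPower.basis_repr_apply, exteriorPower.ιMultiDual_apply_ιMulti, pluckerVec,
    ← Matrix.det_transpose]
  congr 1

theorem pluckerVec_ne_zero {m k : ℕ} {x : Fin k → Fin m → ℂ} (hx : LinearIndependent ℂ x) :
    pluckerVec x ≠ 0 := by
  intro h
  have h0 : exteriorPower.ιMulti ℂ k x = 0 := by
    apply ((Pi.basisFun ℂ (Fin m)).exteriorPower k).repr.injective
    ext K
    rw [← pluckerVec_eq_repr, h, map_zero]
    rfl
  have h1 := (exteriorPower.ιMulti_family_linearIndependent_field (n := k) hx).ne_zero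
    (Set.powersetCard.ofFinEmbEquiv (RelEmbedding.refl _))
  apply h1
  simpa [exteriorPower.ιMulti_family] using! h0

/-- A basis of the vector subspace underlying an `n`-plane. -/
noncomputable def NPlane.basis {n : ℕ} (ℓ : NPlane n) : Basis (Fin (n + 1)) ℂ ℓ.1 :=
  finBasisOfFinrankEq ℂ ℓ.1 ℓ.2

theorem linearIndependent_coe {m k : ℕ} {L : Submodule ℂ (Fin m → ℂ)} (b : Basis (Fin k) ℂ L) :
    LinearIndependent ℂ (fun i => (b i : Fin m → ℂ)) :=
  b.linearIndependent.map' L.subtype L.ker_subtype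

/-- The point `ℓ̂` of the projective space `ℙ^N` of `(n+1)`-vectors given by the Plücker
coordinates of an `n`-plane `ℓ`. -/
noncomputable def NPlane.plucker {n : ℕ} (ℓ : NPlane n) :
    ℙ ℂ (MultiIndex (2 * n + 2) (n + 1) → ℂ) :=
  Projectivization.mk ℂ (pluckerVec fun i => (ℓ.basis i : Fin (2 * n + 2) → ℂ))
    (pluckerVec_ne_zero (linearIndependent_coe ℓ.basis))

/-- The Plücker point can be computed from any basis. -/
theorem NPlane.plucker_eq {n : ℕ} (ℓ : NPlane n) (b : Basis (Fin (n + 1)) ℂ ℓ.1) :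
    ℓ.plucker = Projectivization.mk ℂ (pluckerVec fun i => (b i : Fin (2 * n + 2) → ℂ))
      (pluckerVec_ne_zero (linearIndependent_coe b)) := by
  rw [NPlane.plucker, Projectivization.mk_eq_mk_iff']
  refine ⟨(b.toMatrix ℓ.basis).det, ?_⟩
  ext K
  rw [Pi.smul_apply, smul_eq_mul, mul_comm, pluckerVec, pluckerVec, ← Matrix.det_mul]
  congr 1
  ext i j
  have h : ((∑ t, b.toMatrix ℓ.basis t j • b t : ℓ.1) : Fin (2 * n + 2) → ℂ) = ℓ.basis j := by
    rw [b.sum_toMatrix_smul_self]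
  have h' := congrFun h (enum K i)
  rw [AddSubmonoidClass.coe_finsetSum, Finset.sum_apply] at h'
  rw [Matrix.mul_apply, Matrix.of_apply, ← h']
  refine Finset.sum_congr rfl fun t _ => ?_
  simp [mul_comm]

/-! ### Limit `n`-planes, the limit set, and groups of type `L` -/

/-- `ℓ` is a limit `n`-plane of `Γ`: there is a sequence `σ` in `Γ` such that `σ` and `ρ ∘ σ` are
normal, with `ℓ̂` in the limit image of `ρ ∘ σ`. -/
def IsLimitPlane {n : ℕ} (Γ : Subgroup PGL(Fin (2 * n + 2), ℂ)) (ℓ : NPlane n) : Prop :=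
  ∃ σ : ℕ → PGL(Fin (2 * n + 2), ℂ), (∀ ν, σ ν ∈ Γ) ∧ IsNormalSeq σ ∧
    IsNormalSeq (fun ν => rho (2 * n + 2) (n + 1) (σ ν)) ∧
    ℓ.plucker ∈ limitImage (fun ν => rho (2 * n + 2) (n + 1) (σ ν))

/-- The limit set `Λ(Γ)`: the union of the limit `n`-planes. -/
def limitSet {n : ℕ} (Γ : Subgroup PGL(Fin (2 * n + 2), ℂ)) : Set (Proj n) :=
  ⋃ ℓ ∈ {ℓ : NPlane n | IsLimitPlane Γ ℓ}, ℓ.support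

/-- The set of discontinuity `Ω(Γ)`. -/
def discontinuitySet {n : ℕ} (Γ : Subgroup PGL(Fin (2 * n + 2), ℂ)) : Set (Proj n) :=
  (limitSet Γ)ᶜ

/-- A large domain: a connected open set that contains an `n`-plane. -/
def IsLargeDomain {n : ℕ} (D : Set (Proj n)) : Prop :=
  IsOpen D ∧ IsConnected D ∧ ∃ ℓ : NPlane n, ℓ.support ⊆ D

/-- Groups of type `L`: discrete subgroups of `PGL_{2n+2}(ℂ)` such that `Ω(Γ)` contains a large
domain. -/
def IsTypeL {n : ℕ} (Γ : Subgroup PGL(Fin (2 * n + 2), ℂ)) : Prop :=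
  DiscreteTopology Γ ∧ ∃ D : Set (Proj n), IsLargeDomain D ∧ D ⊆ discontinuitySet Γ

end TypeL

/-! Write each group element as `u * diagonal d * v` with `u`, `v` unitary and `d` positive and
decreasing. The compound matrix is then `compound u * diagonal (indexProd d) * compound v`, and its
largest diagonal entry is the product of the first `n + 1` singular values. Along a subsequence the
unitary factors converge to `U` and `V`, and the products divided by the largest one converge to
`r`. The limit image is then `compound U` applied to the coordinate subspace where `r` is nonzero.

Suppose that an `n`-plane `ℓ` lies in `Ω(Γ)`. If `d (n+1) / d n` did not tend to zero, the limit
image would contain a pencil of `n`-planes sweeping out an `(n+1)`-plane, and this would meet `ℓ`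
for reasons of dimension (`IsCartanLimit.apply_nextIndex`). So there is a gap between the middle
singular values, every other normalised product dies, and the limit image is a single point,
representing the span of the first `n + 1` columns of `U`
(`IsCartanLimit.plucker_mem_limitImage_iff`).

Hence `Λ(Γ)` is a union of such spans over a compact set of matrices `U` (`mk_mem_limitSet_iff`),
which makes it closed. It is invariant because left multiplication by an element of `Γ` carries
normal sequences to normal sequences and limit planes to limit planes.

For the empty interior, the inverse sequence has a gap too, and its limit plane is the one
contracted by the original sequence. That plane misses `ℓ`, so the images of `ℓ` accumulate at every
point of the limit plane of the original sequence (`IsCartanSeq.exists_tendsto`). These images avoid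
`Λ(Γ)` by invariance, so no point of `Λ(Γ)` is interior. -/

namespace TypeL

/-! ### Singular value decompositions -/

/-- `a = u * diag d * v` is a singular value decomposition of `a`, with decreasing singular
values. -/
structure IsCartan {m : ℕ} (a : GL (Fin m) ℂ) (u : Matrix (Fin m) (Fin m) ℂ) (d : Fin m → ℝ)
    (v : Matrix (Fin m) (Fin m) ℂ) : Prop where
  left_mem : u ∈ unitaryGroup (Fin m) ℂ
  right_mem : v ∈ unitaryGroup (Fin m) ℂ
  pos : ∀ i, 0 < d i
  anti : Antitone d
  eq : (a : Matrix (Fin m) (Fin m) ℂ) = u * diagonal (fun i => (d i : ℂ)) * v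

-- A unitary `W` diagonalises the positive definite `Aᴴ * A`. Permute its columns so that the square
-- roots `d` of the eigenvalues decrease; then `A * W' * D⁻¹` is unitary and serves as the left
-- factor.
open scoped ComplexOrder in
theorem exists_isCartan {m : ℕ} (a : GL (Fin m) ℂ) : ∃ u d v, IsCartan a u d v := by
  set A : Matrix (Fin m) (Fin m) ℂ := (a : Matrix (Fin m) (Fin m) ℂ) with hA
  have hpd : (Aᴴ * A).PosDef := by
    refine Matrix.PosDef.conjTranspose_mul_self A ?_
    exact (Matrix.mulVec_injective_iff_isUnit.2 a.isUnit)
  have hH : (Aᴴ * A).IsHermitian := hpd.1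
  set l := hH.eigenvalues with hl
  have hlpos : ∀ i, 0 < l i := fun i => hpd.eigenvalues_pos i
  set p : Equiv.Perm (Fin m) := Tuple.sort (fun i => -√(l i)) with hp
  set d : Fin m → ℝ := fun i => √(l (p i)) with hd
  have hdpos : ∀ i, 0 < d i := fun i => Real.sqrt_pos.2 (hlpos _)
  have hanti : Antitone d := by
    intro i j hij
    have := Tuple.monotone_sort (fun i => -√(l i)) hij
    simpa [hd, hp] using this
  set W : Matrix (Fin m) (Fin m) ℂ :=
    (hH.eigenvectorUnitary : Matrix (Fin m) (Fin m) ℂ) with hW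
  have hWu : star W * W = 1 := (Unitary.mem_iff.1 hH.eigenvectorUnitary.2).1
  have hspec : star W * (Aᴴ * A) * W = diagonal (fun i => (l i : ℂ)) := by
    have h := hH.spectral_theorem
    rw [Unitary.conjStarAlgAut_apply] at h
    conv_lhs => rw [h]
    change star W * (W * diagonal (fun i => (l i : ℂ)) * star W) * W = _
    rw [← mul_assoc, ← mul_assoc, hWu, one_mul, mul_assoc, hWu, mul_one]
  set W' : Matrix (Fin m) (Fin m) ℂ := W.submatrix id p with hW'
  have hW'1 : star W' * W' = 1 := by
    have : star W' * W' = (star W * W).submatrix p p := by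
      ext i j; simp [hW', Matrix.mul_apply, Matrix.star_apply]
    rw [this, hWu]; simp
  have hW'2 : W' * star W' = 1 := mul_eq_one_comm.1 hW'1
  have hspec' : star W' * (Aᴴ * A) * W' = diagonal (fun i => (d i : ℂ) * d i) := by
    have h1 : star W' * (Aᴴ * A) * W' = (star W * (Aᴴ * A) * W).submatrix p p := by
      ext i j
      simp [hW', Matrix.mul_apply, Matrix.star_apply]
    rw [h1, hspec]
    ext i j
    by_cases hij : i = j
    · subst hij
      simp only [submatrix_apply, diagonal_apply_eq, hd]
      rw [← Complex.ofReal_mul, Real.mul_self_sqrt (hlpos _).le]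
    · simp [hij]
  set D : Matrix (Fin m) (Fin m) ℂ := diagonal (fun i => (d i : ℂ)) with hD
  set D' : Matrix (Fin m) (Fin m) ℂ := diagonal (fun i => ((d i : ℂ))⁻¹) with hD'
  have hne : ∀ i, (d i : ℂ) ≠ 0 := fun i => by exact_mod_cast (hdpos i).ne'
  have hDD' : D' * D = 1 := by
    rw [hD, hD', diagonal_mul_diagonal, ← diagonal_one]
    congr 1; ext i; simp [hne i]
  have hstarD' : star D' = D' := by
    rw [hD', star_eq_conjTranspose, diagonal_conjTranspose]
    congr 1; ext i; simp
  refine ⟨A * W' * D', d, star W', ?_, ?_, hdpos, hanti, ?_⟩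
  · rw [mem_unitaryGroup_iff', star_mul, star_mul, hstarD']
    have : D' * (star W' * star A) * (A * W' * D') = D' * (star W' * (Aᴴ * A) * W') * D' := by
      simp only [star_eq_conjTranspose, mul_assoc]
    rw [this, hspec', hD', diagonal_mul_diagonal, diagonal_mul_diagonal, ← diagonal_one]
    congr 1; ext i; field_simp [hne i]
  · rw [mem_unitaryGroup_iff', star_star]; exact hW'2
  · rw [mul_assoc _ D', hDD', mul_one, mul_assoc, hW'2, mul_one]

/-- Inverting the factorisation makes the singular values increase; conjugating by the reversal of
indices restores the decreasing order. -/
theorem IsCartan.inv {m : ℕ} {a : GL (Fin m) ℂ} {u v : Matrix (Fin m) (Fin m) ℂ} {d : Fin m → ℝ}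
    (h : IsCartan a u d v) :
    IsCartan a⁻¹ ((star v).submatrix id Fin.rev) (fun i => (d i.rev)⁻¹)
      ((star u).submatrix Fin.rev id) := by
  have hu := mem_unitaryGroup_iff.1 h.left_mem
  have hu' := mem_unitaryGroup_iff'.1 h.left_mem
  have hv := mem_unitaryGroup_iff.1 h.right_mem
  have hne : ∀ i, (d i : ℂ) ≠ 0 := fun i => by exact_mod_cast (h.pos i).ne'
  refine ⟨?_, ?_, fun i => inv_pos.2 (h.pos _), ?_, ?_⟩
  · rw [mem_unitaryGroup_iff']
    have : star ((star v).submatrix id Fin.rev) * (star v).submatrix id Fin.rev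
        = (v * star v).submatrix Fin.rev Fin.rev := by
      ext i j; simp [Matrix.mul_apply, Matrix.star_apply]
    rw [this, hv]
    exact submatrix_one _ Fin.rev_injective
  · rw [mem_unitaryGroup_iff]
    have : (star u).submatrix Fin.rev id * star ((star u).submatrix Fin.rev id)
        = (star u * u).submatrix Fin.rev Fin.rev := by
      ext i j; simp [Matrix.mul_apply, Matrix.star_apply]
    rw [this, hu']
    exact submatrix_one _ Fin.rev_injective
  · intro i j hij
    have := h.anti (Fin.rev_le_rev.2 hij)
    exact inv_anti₀ (h.pos _) this
  · have h1 : (star v).submatrix id Fin.rev * diagonal (fun i : Fin m => (((d i.rev)⁻¹ : ℝ) : ℂ)) *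
        (star u).submatrix Fin.rev id = star v * diagonal (fun i => (d i : ℂ)⁻¹) * star u := by
      ext i j
      rw [Matrix.mul_apply, Matrix.mul_apply]
      simp only [mul_diagonal, submatrix_apply, id]
      refine Fintype.sum_equiv Fin.revPerm _ _ fun k => ?_
      simp
    rw [h1]
    refine (Units.inv_eq_of_mul_eq_one_right ?_ :
      ((a⁻¹ : GL (Fin m) ℂ) : Matrix (Fin m) (Fin m) ℂ) = _)
    rw [h.eq]
    have : u * diagonal (fun i => (d i : ℂ)) * v * (star v * diagonal (fun i => (d i : ℂ)⁻¹) * star u)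
      = u * (diagonal (fun i => (d i : ℂ)) * (v * star v) * diagonal (fun i => (d i : ℂ)⁻¹)) *
        star u := by
      simp only [mul_assoc]
    rw [this, hv, mul_one, diagonal_mul_diagonal]
    have : (fun i => (d i : ℂ) * (d i : ℂ)⁻¹) = fun _ => 1 := by
      ext i; simp [hne i]
    rw [this, diagonal_one, mul_one, hu]

/-! ### Compactness of the unitary group -/

theorem isClosed_unitaryGroup (m : ℕ) :
    IsClosed (unitaryGroup (Fin m) ℂ : Set (Matrix (Fin m) (Fin m) ℂ)) := by
  have : (unitaryGroup (Fin m) ℂ : Set (Matrix (Fin m) (Fin m) ℂ)) = {A | A * star A = 1} := by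
    ext A; exact mem_unitaryGroup_iff
  rw [this]
  exact isClosed_eq (continuous_id.mul continuous_star) continuous_const

instance instFirstCountableTopologyMatrix (m : ℕ) :
    FirstCountableTopology (Matrix (Fin m) (Fin m) ℂ) :=
  inferInstanceAs (FirstCountableTopology (Fin m → Fin m → ℂ))

theorem isCompact_unitaryGroup (m : ℕ) :
    IsCompact (unitaryGroup (Fin m) ℂ : Set (Matrix (Fin m) (Fin m) ℂ)) := by
  have hK : IsCompact (Set.pi Set.univ fun _ : Fin m => Set.pi Set.univ fun _ : Fin m =>
      Metric.closedBall (0 : ℂ) 1) :=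
    isCompact_univ_pi fun _ => isCompact_univ_pi fun _ => isCompact_closedBall _ _
  refine IsCompact.of_isClosed_subset (X := Matrix (Fin m) (Fin m) ℂ) hK
    (isClosed_unitaryGroup m) ?_
  intro A hA i _ j _
  simpa using entry_norm_bound_of_unitary hA i j

/-! ### Compound matrices -/

theorem continuous_compound {m : ℕ} (k : ℕ) : Continuous (compound (m := m) k) := by
  refine continuous_matrix fun K J => ?_
  simp only [compound, of_apply]
  exact Continuous.matrix_det (continuous_id.matrix_submatrix _ _)

theorem compound_mul {m : ℕ} (k : ℕ) (A B : Matrix (Fin m) (Fin m) ℂ) :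
    compound k (A * B) = compound k A * compound k B :=
  (compoundHom m k).map_mul A B

theorem compound_one {m : ℕ} (k : ℕ) : compound k (1 : Matrix (Fin m) (Fin m) ℂ) = 1 :=
  (compoundHom m k).map_one

theorem mem_range_enum {m k : ℕ} (I : MultiIndex m k) (i : Fin m) :
    i ∈ Set.range (enum I) ↔ i ∈ I :=
  Set.powersetCard.mem_range_ofFinEmbEquiv_symm_iff_mem I i

theorem compound_diagonal {m : ℕ} (k : ℕ) (d : Fin m → ℂ) :
    compound k (diagonal d) = diagonal fun I : MultiIndex m k => ∏ i, d (enum I i) := by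
  ext K J
  by_cases h : K = J
  · subst h
    rw [diagonal_apply_eq, compound, of_apply, submatrix_diagonal _ _ (enum K).injective,
      det_diagonal]
    rfl
  · rw [diagonal_apply_ne _ h, compound, of_apply]
    obtain ⟨x, hx, hx'⟩ := (Set.powersetCard.exists_mem_notMem_iff_ne K J).1 h
    obtain ⟨i, rfl⟩ := (mem_range_enum K x).2 hx
    refine det_eq_zero_of_row_eq_zero i fun j => ?_
    rw [submatrix_apply, diagonal_apply_ne]
    intro hij
    exact hx' ((mem_range_enum J _).1 ⟨j, hij.symm⟩)

theorem rho_mk {m : ℕ} (k : ℕ) (a : GL (Fin m) ℂ) :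
    rho m k (ProjGenLinGroup.mk a) = ProjGenLinGroup.mk (Units.map (compoundHom m k) a) := rfl

theorem coe_map_compoundHom {m : ℕ} (k : ℕ) (a : GL (Fin m) ℂ) :
    ((Units.map (compoundHom m k) a : GL (MultiIndex m k) ℂ) : Matrix _ _ ℂ)
      = compound k (a : Matrix (Fin m) (Fin m) ℂ) := rfl

/-! ### Plücker vectors -/

theorem pluckerVec_mulVec {m k : ℕ} (A : Matrix (Fin m) (Fin m) ℂ) (x : Fin k → Fin m → ℂ) :
    pluckerVec (fun i => A *ᵥ x i) = compound k A *ᵥ pluckerVec x := by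
  have h : ∀ y : Fin k → Fin m → ℂ, pluckerVec y =
      ⇑(((Pi.basisFun ℂ (Fin m)).exteriorPower k).repr (exteriorPower.ιMulti ℂ k y)) :=
    fun y => funext fun K => pluckerVec_eq_repr y K
  rw [h x, compound_eq_toMatrix, LinearMap.toMatrix_mulVec_repr, exteriorPower.map_apply_ιMulti, h]
  rfl

theorem pluckerVec_single {m k : ℕ} (J : MultiIndex m k) :
    pluckerVec (fun i => (Pi.single (enum J i) 1 : Fin m → ℂ)) = Pi.single J 1 := by
  ext K
  have h := congrFun (congrFun (compound_one (m := m) k) K) J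
  rw [compound, of_apply] at h
  rw [pluckerVec, show (Pi.single J 1 : MultiIndex m k → ℂ) K = (1 : Matrix _ _ ℂ) K J by
    simp [one_apply, Pi.single_apply], ← h]
  congr 1
  ext i j
  simp [one_apply, Pi.single_apply]

/-- Proportional Plücker vectors span the same subspace. -/
theorem span_le_span_of_pluckerVec_eq_smul {m k : ℕ} {x y : Fin k → Fin m → ℂ}
    (hy : LinearIndependent ℂ y) {c : ℂ}
    (h : pluckerVec y = c • pluckerVec x) :
    Submodule.span ℂ (Set.range x) ≤ Submodule.span ℂ (Set.range y) := by
  have hM : exteriorPower.ιMulti ℂ k y = c • exteriorPower.ιMulti ℂ k x := by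
    apply ((Pi.basisFun ℂ (Fin m)).exteriorPower k).repr.injective
    ext K
    rw [map_smul, Finsupp.smul_apply, ← pluckerVec_eq_repr, ← pluckerVec_eq_repr, h,
      Pi.smul_apply]
  have hM' : ExteriorAlgebra.ιMulti ℂ k y = c • ExteriorAlgebra.ιMulti ℂ k x := by
    simpa using congrArg Subtype.val hM
  refine Submodule.span_le.2 ?_
  rintro _ ⟨i, rfl⟩
  -- If `x i` were outside the span of `y`, then `x i ∧ y_1 ∧ ⋯ ∧ y_k` would be nonzero. But it is
  -- `c` times a wedge in which `x i` occurs twice.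
  by_contra hi
  have hli : LinearIndependent ℂ (Fin.cons (x i) y : Fin (k + 1) → Fin m → ℂ) :=
    linearIndependent_finCons.2 ⟨hy, hi⟩
  have h0 : ExteriorAlgebra.ιMulti ℂ (k + 1) (Fin.cons (x i) y : Fin (k + 1) → Fin m → ℂ) = 0 := by
    rw [ExteriorAlgebra.ιMulti_succ_apply]
    have h1 : ExteriorAlgebra.ιMulti ℂ (k + 1) (Fin.cons (x i) x : Fin (k + 1) → Fin m → ℂ) = 0 :=
      AlternatingMap.map_eq_zero_of_eq _ _ (i := 0) (j := i.succ) (by simp) (Fin.succ_ne_zero i).symm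
    rw [ExteriorAlgebra.ιMulti_succ_apply] at h1
    simp only [Fin.cons_zero, Matrix.vecTail, Function.comp_def, Fin.cons_succ] at h1 ⊢
    change _ * ExteriorAlgebra.ιMulti ℂ k x = 0 at h1
    change _ * ExteriorAlgebra.ιMulti ℂ k y = 0
    rw [hM', mul_smul_comm, h1, smul_zero]
  apply pluckerVec_ne_zero hli
  ext K
  have h2 : exteriorPower.ιMulti ℂ (k + 1) (Fin.cons (x i) y : Fin (k + 1) → Fin m → ℂ) = 0 :=
    Subtype.ext h0
  rw [pluckerVec_eq_repr, h2]
  simp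

/-! ### Planes spanned by independent vectors -/

/-- The `n`-plane spanned by independent vectors. -/
noncomputable def NPlane.ofLinearIndependent {n : ℕ} {x : Fin (n + 1) → Fin (2 * n + 2) → ℂ}
    (hx : LinearIndependent ℂ x) : NPlane n :=
  ⟨Submodule.span ℂ (Set.range x), by rw [finrank_span_eq_card hx, Fintype.card_fin]⟩

theorem NPlane.plucker_ofLinearIndependent {n : ℕ} {x : Fin (n + 1) → Fin (2 * n + 2) → ℂ}
    (hx : LinearIndependent ℂ x) :
    (NPlane.ofLinearIndependent hx).plucker =
      Projectivization.mk ℂ (pluckerVec x) (pluckerVec_ne_zero hx) := by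
  rw [NPlane.plucker_eq _ (Basis.span hx)]
  congr 1
  congr 1
  ext i j
  exact congrFun (congrArg Subtype.val (Basis.span_apply hx i)) j

theorem NPlane.span_basis {n : ℕ} (ℓ : NPlane n) :
    Submodule.span ℂ (Set.range fun i => (ℓ.basis i : Fin (2 * n + 2) → ℂ)) = ℓ.1 := by
  have h := congrArg (Submodule.map ℓ.1.subtype) ℓ.basis.span_eq
  rw [Submodule.map_span, Submodule.map_top, Submodule.range_subtype, ← Set.range_comp] at h
  exact h

theorem NPlane.plucker_injective {n : ℕ} : Function.Injective (NPlane.plucker (n := n)) := by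
  intro ℓ ℓ' h
  have key : ∀ {ℓ ℓ' : NPlane n}, ℓ.plucker = ℓ'.plucker → ℓ'.1 ≤ ℓ.1 := by
    intro ℓ ℓ' h
    rw [NPlane.plucker, NPlane.plucker, Projectivization.mk_eq_mk_iff'] at h
    obtain ⟨c, hc⟩ := h
    have := span_le_span_of_pluckerVec_eq_smul (linearIndependent_coe ℓ.basis) hc.symm
    rwa [ℓ.span_basis, ℓ'.span_basis] at this
  exact Subtype.ext (le_antisymm (key h.symm) (key h))

theorem NPlane.mk_mem_support {n : ℕ} (ℓ : NPlane n) {v : Fin (2 * n + 2) → ℂ} (hv : v ≠ 0) :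
    Projectivization.mk ℂ v hv ∈ ℓ.support ↔ v ∈ ℓ.1 := Iff.rfl

/-! ### Limits of sequences in `PGL` -/

section MaxAbs

variable {ι : Type*} [Fintype ι]

theorem continuous_maxAbs : Continuous (maxAbs (ι := ι)) := by
  refine NNReal.continuous_coe.comp (Continuous.finset_sup_apply fun p _ => ?_)
  exact (continuous_id.matrix_elem p.1 p.2).nnnorm

theorem maxAbs_smul (c : ℂ) (A : Matrix ι ι ℂ) : maxAbs (c • A) = ‖c‖ * maxAbs A := by
  rw [maxAbs, maxAbs, ← coe_nnnorm, ← NNReal.coe_mul, NNReal.mul_finset_sup]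
  simp

theorem maxAbs_pos {A : Matrix ι ι ℂ} (hA : A ≠ 0) : 0 < maxAbs A := by
  obtain ⟨i, j, hij⟩ : ∃ i j, A i j ≠ 0 := by
    by_contra! h
    exact hA (Matrix.ext h)
  refine lt_of_lt_of_le (norm_pos_iff.2 hij) ?_
  rw [maxAbs, ← coe_nnnorm, NNReal.coe_le_coe]
  exact Finset.le_sup (f := fun p : ι × ι => ‖A p.1 p.2‖₊) (Finset.mem_univ (i, j))

/-- Any convergent rescaling with nonzero limit may replace the normalised one: divide by `maxAbs`,
which is continuous and nonzero at the limit. -/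
theorem isLimitMatrix_of_tendsto [DecidableEq ι] {σ : ℕ → PGL(ι, ℂ)} {B : ℕ → GL ι ℂ} {c : ℕ → ℂ}
    {S : Matrix ι ι ℂ} (hσ : ∀ ν, ProjGenLinGroup.mk (B ν) = σ ν) (hc : ∀ ν, c ν ≠ 0)
    (hB : ∀ ν, (B ν : Matrix ι ι ℂ) ≠ 0)
    (hS : S ≠ 0) (h : Tendsto (fun ν => c ν • (B ν : Matrix ι ι ℂ)) atTop (𝓝 S)) :
    IsLimitMatrix σ (((maxAbs S : ℂ)⁻¹) • S) := by
  have hne : ∀ ν, c ν • (B ν : Matrix ι ι ℂ) ≠ 0 := fun ν => smul_ne_zero (hc ν) (hB ν)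
  have ht : ∀ ν, ((maxAbs (c ν • (B ν : Matrix ι ι ℂ)) : ℂ)⁻¹ * c ν) ≠ 0 := fun ν =>
    mul_ne_zero (inv_ne_zero (by exact_mod_cast (maxAbs_pos (hne ν)).ne')) (hc ν)
  have hval : ∀ ν, ((B ν * GeneralLinearGroup.scalar ι (Units.mk0 _ (ht ν)) : GL ι ℂ) :
      Matrix ι ι ℂ) = ((maxAbs (c ν • (B ν : Matrix ι ι ℂ)) : ℂ)⁻¹) • (c ν • (B ν : Matrix ι ι ℂ)) := by
    intro ν
    rw [smul_smul, Units.val_mul, GeneralLinearGroup.coe_scalar]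
    ext i j
    simp [Matrix.scalar_apply, mul_comm]
  refine ⟨fun ν => B ν * GeneralLinearGroup.scalar ι (Units.mk0 _ (ht ν)), fun ν => ⟨?_, ?_⟩, ?_⟩
  · rw [map_mul, ProjGenLinGroup.mk_scalar, mul_one, hσ]
  · rw [hval, maxAbs_smul, norm_inv, Complex.norm_real, Real.norm_of_nonneg (maxAbs_pos (hne ν)).le]
    exact inv_mul_cancel₀ (maxAbs_pos (hne ν)).ne'
  · simp only [hval]
    refine Tendsto.smul (Tendsto.inv₀ ?_ (by exact_mod_cast (maxAbs_pos hS).ne')) h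
    exact (Complex.continuous_ofReal.tendsto _).comp ((continuous_maxAbs.tendsto S).comp h)

theorem IsLimitMatrix.ne_zero [DecidableEq ι] {σ : ℕ → PGL(ι, ℂ)} {S : Matrix ι ι ℂ}
    (hS : IsLimitMatrix σ S) : S ≠ 0 := by
  obtain ⟨T, hT, hlim⟩ := hS
  rintro rfl
  have h1 := (continuous_maxAbs.tendsto (0 : Matrix ι ι ℂ)).comp hlim
  have h2 : maxAbs (0 : Matrix ι ι ℂ) = 0 := by simpa using maxAbs_smul 0 (0 : Matrix ι ι ℂ)
  have h3 : (maxAbs ∘ fun ν => (T ν : Matrix ι ι ℂ)) = fun _ => 1 := funext fun ν => (hT ν).2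
  rw [h2, h3] at h1
  exact one_ne_zero (tendsto_nhds_unique tendsto_const_nhds h1)

/-- The two choices of representatives differ by scalars `t ν`. Reading them off at an entry where
`S` is nonzero shows that they converge. -/
theorem IsLimitMatrix.eq_smul [DecidableEq ι] {σ : ℕ → PGL(ι, ℂ)} {B : ℕ → GL ι ℂ} {c : ℕ → ℂ}
    {S S' : Matrix ι ι ℂ} (hS' : IsLimitMatrix σ S')
    (hσ : ∀ ν, ProjGenLinGroup.mk (B ν) = σ ν) (hc : ∀ ν, c ν ≠ 0)
    (hS : S ≠ 0) (h : Tendsto (fun ν => c ν • (B ν : Matrix ι ι ℂ)) atTop (𝓝 S)) :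
    ∃ t : ℂ, t ≠ 0 ∧ S' = t • S := by
  have hS'0 := hS'.ne_zero
  obtain ⟨T, hT, hlim⟩ := hS'
  have ht : ∀ ν, ∃ t : ℂ, (T ν : Matrix ι ι ℂ) = t • (c ν • (B ν : Matrix ι ι ℂ)) := by
    intro ν
    obtain ⟨z, hz⟩ := ProjGenLinGroup.mk_eq_mk_iff.1 ((hσ ν).trans (hT ν).1.symm)
    refine ⟨z * (c ν)⁻¹, ?_⟩
    rw [smul_smul, mul_assoc, inv_mul_cancel₀ (hc ν), mul_one, ← hz, Units.val_mul,
      GeneralLinearGroup.coe_scalar]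
    ext i j
    simp [Matrix.scalar_apply, mul_comm]
  choose t ht using ht
  obtain ⟨i, j, hij⟩ : ∃ i j, S i j ≠ 0 := by
    by_contra! h
    exact hS (Matrix.ext h)
  have hTij : Tendsto (fun ν => (T ν : Matrix ι ι ℂ) i j) atTop (𝓝 (S' i j)) :=
    ((continuous_id.matrix_elem i j).tendsto S').comp hlim
  have hBij : Tendsto (fun ν => (c ν • (B ν : Matrix ι ι ℂ)) i j) atTop (𝓝 (S i j)) :=
    ((continuous_id.matrix_elem i j).tendsto S).comp h
  have htlim : Tendsto t atTop (𝓝 (S' i j / S i j)) := by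
    refine (hTij.div hBij hij).congr' ?_
    filter_upwards [hBij.eventually_ne hij] with ν hν
    rw [Pi.div_apply, ht ν, Matrix.smul_apply (t ν), smul_eq_mul, mul_div_assoc, div_self hν, mul_one]
  have heq : S' = (S' i j / S i j) • S := by
    refine tendsto_nhds_unique hlim ?_
    simp only [ht]
    exact htlim.smul h
  refine ⟨_, fun h0 => ?_, heq⟩
  rw [h0, zero_smul] at heq
  exact hS'0 heq

theorem mem_limitImage_iff [DecidableEq ι] {σ : ℕ → PGL(ι, ℂ)} {B : ℕ → GL ι ℂ} {c : ℕ → ℂ}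
    {S : Matrix ι ι ℂ} (hσ : ∀ ν, ProjGenLinGroup.mk (B ν) = σ ν) (hc : ∀ ν, c ν ≠ 0)
    (hB : ∀ ν, (B ν : Matrix ι ι ℂ) ≠ 0)
    (hS : S ≠ 0) (h : Tendsto (fun ν => c ν • (B ν : Matrix ι ι ℂ)) atTop (𝓝 S))
    {w : ι → ℂ} (hw : w ≠ 0) :
    Projectivization.mk ℂ w hw ∈ limitImage σ ↔ ∃ z, S *ᵥ z = w := by
  have hr : ∀ (t : ℂ) (S' : Matrix ι ι ℂ), t ≠ 0 → S' = t • S →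
      (Projectivization.mk ℂ w hw ∈ (LinearMap.range (Matrix.toLin' S')).projectivization ↔
        ∃ z, S *ᵥ z = w) := by
    rintro t _ ht rfl
    rw [Submodule.mk_mem_projectivization_iff, LinearMap.mem_range]
    constructor
    · rintro ⟨z, hz⟩
      exact ⟨t • z, by rw [mulVec_smul, ← smul_mulVec, ← hz, toLin'_apply]⟩
    · rintro ⟨z, hz⟩
      exact ⟨t⁻¹ • z, by rw [toLin'_apply, mulVec_smul, smul_mulVec, smul_smul,
        inv_mul_cancel₀ ht, one_smul, hz]⟩
  constructor
  · rintro ⟨S', hS', hp⟩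
    obtain ⟨t, ht, hS't⟩ := hS'.eq_smul hσ hc hS h
    exact (hr t S' ht hS't).1 hp
  · intro hz
    refine ⟨_, isLimitMatrix_of_tendsto hσ hc hB hS h, (hr _ _ ?_ rfl).2 hz⟩
    exact inv_ne_zero (by exact_mod_cast (maxAbs_pos hS).ne')

/-- Since `g` is invertible, `g * S` is nonzero; the scalar `t` only restores norm one. -/
theorem IsLimitMatrix.mul_left [DecidableEq ι] {σ : ℕ → PGL(ι, ℂ)} {S : Matrix ι ι ℂ}
    (hS : IsLimitMatrix σ S) (g : GL ι ℂ) : ∃ t : ℂ, t ≠ 0 ∧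
      IsLimitMatrix (fun ν => ProjGenLinGroup.mk g * σ ν) (t • ((g : Matrix ι ι ℂ) * S)) := by
  have hS0 := hS.ne_zero
  obtain ⟨T, hT, hlim⟩ := hS
  have : Nontrivial (Matrix ι ι ℂ) := ⟨S, 0, hS0⟩
  have hg : (g : Matrix ι ι ℂ) * S ≠ 0 := by rwa [Ne, g.mul_right_eq_zero]
  refine ⟨_, inv_ne_zero (by exact_mod_cast (maxAbs_pos hg).ne'),
    isLimitMatrix_of_tendsto (B := fun ν => g * T ν) (c := fun _ => 1)
      (fun ν => by rw [map_mul, (hT ν).1]) (fun _ => one_ne_zero) (fun ν => Units.ne_zero _) hg ?_⟩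
  simp only [one_smul, Units.val_mul]
  exact tendsto_const_nhds.mul hlim

theorem IsNormalSeq.mul_left [DecidableEq ι] {σ : ℕ → PGL(ι, ℂ)} (hσ : IsNormalSeq σ)
    (g : GL ι ℂ) : IsNormalSeq (fun ν => ProjGenLinGroup.mk g * σ ν) := by
  obtain ⟨hinj, S, hS⟩ := hσ
  obtain ⟨t, -, ht⟩ := hS.mul_left g
  exact ⟨fun i j hij => hinj (mul_left_cancel hij), _, ht⟩

theorem mk_mulVec_mem_limitImage [DecidableEq ι] {σ : ℕ → PGL(ι, ℂ)} (g : GL ι ℂ) {w w' : ι → ℂ}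
    {hw : w ≠ 0} {hw' : w' ≠ 0} (h : Projectivization.mk ℂ w hw ∈ limitImage σ)
    (hgw : w' = (g : Matrix ι ι ℂ) *ᵥ w) :
    Projectivization.mk ℂ w' hw' ∈ limitImage (fun ν => ProjGenLinGroup.mk g * σ ν) := by
  obtain ⟨S, hS, hp⟩ := h
  obtain ⟨t, ht0, ht⟩ := hS.mul_left g
  obtain ⟨z, rfl⟩ := hp
  refine ⟨_, ht, t⁻¹ • z, ?_⟩
  change _ = w'
  rw [hgw, toLin'_apply, toLin'_apply, mulVec_smul, smul_mulVec, smul_smul, inv_mul_cancel₀ ht0,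
    one_smul, mulVec_mulVec]

end MaxAbs

theorem coe_GL_ne_zero {ι : Type*} [Fintype ι] [DecidableEq ι] [Nonempty ι] (g : GL ι ℂ) :
    (g : Matrix ι ι ℂ) ≠ 0 := g.ne_zero

/-! ### Products of singular values -/

/-- The indices `0, …, n`. -/
noncomputable def topIndex (n : ℕ) : MultiIndex (2 * n + 2) (n + 1) :=
  Set.powersetCard.ofFinEmbEquiv (Fin.castLEOrderEmb (by omega))

theorem enum_topIndex {n : ℕ} (i : Fin (n + 1)) :
    enum (topIndex n) i = Fin.castLE (by omega) i := by
  rw [enum, topIndex, Equiv.symm_apply_apply]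
  rfl

/-- The indices `0, …, n - 1, n + 1`. -/
noncomputable def nextIndex (n : ℕ) : MultiIndex (2 * n + 2) (n + 1) :=
  Set.powersetCard.ofFinEmbEquiv <| OrderEmbedding.ofStrictMono
    (fun i : Fin (n + 1) => (⟨if (i : ℕ) < n then i else n + 1, by split_ifs <;> omega⟩ :
      Fin (2 * n + 2))) <| by
    intro i j hij
    have h1 : (i : ℕ) < j := hij
    have h2 : (j : ℕ) < n + 1 := j.2
    simp only [Fin.mk_lt_mk]
    split_ifs <;> omega

theorem enum_nextIndex {n : ℕ} (i : Fin (n + 1)) :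
    enum (nextIndex n) i = ⟨if (i : ℕ) < n then i else n + 1, by split_ifs <;> omega⟩ := by
  rw [enum, nextIndex, Equiv.symm_apply_apply]
  rfl

instance instNonemptyMultiIndex (n : ℕ) : Nonempty (MultiIndex (2 * n + 2) (n + 1)) :=
  ⟨topIndex n⟩

/-- The product of the singular values with indices in `I`. -/
noncomputable def indexProd {m k : ℕ} (d : Fin m → ℝ) (I : MultiIndex m k) : ℝ :=
  ∏ i, d (enum I i)

theorem indexProd_pos {m k : ℕ} {d : Fin m → ℝ} (hd : ∀ i, 0 < d i) (I : MultiIndex m k) :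
    0 < indexProd d I :=
  Finset.prod_pos fun _ _ => hd _

theorem le_enum {m k : ℕ} (I : MultiIndex m k) (i : Fin k) : (i : ℕ) ≤ enum I i := by
  obtain ⟨i, hi⟩ := i
  induction i with
  | zero => exact Nat.zero_le _
  | succ j ih =>
    have h1 := ih (by omega)
    have h2 : enum I ⟨j, by omega⟩ < enum I ⟨j + 1, hi⟩ := (enum I).strictMono (by simp)
    have h3 : (enum I ⟨j, by omega⟩ : ℕ) < enum I ⟨j + 1, hi⟩ := h2
    simp only at h1 ⊢
    omega

theorem indexProd_le {n : ℕ} {d : Fin (2 * n + 2) → ℝ} (hd : ∀ i, 0 < d i) (ha : Antitone d)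
    (I : MultiIndex (2 * n + 2) (n + 1)) : indexProd d I ≤ indexProd d (topIndex n) := by
  refine Finset.prod_le_prod (fun i _ => (hd _).le) fun i _ => ha ?_
  rw [enum_topIndex]
  exact le_enum I i

theorem lt_enum_last {n : ℕ} {I : MultiIndex (2 * n + 2) (n + 1)} (hI : I ≠ topIndex n) :
    n + 1 ≤ (enum I (Fin.last n) : ℕ) := by
  by_contra! h
  apply hI
  rw [Set.powersetCard.eq_iff_subset]
  intro x hx
  obtain ⟨i, rfl⟩ := (mem_range_enum I x).2 hx
  refine (mem_range_enum (topIndex n) _).1 ⟨⟨enum I i, ?_⟩, ?_⟩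
  · exact lt_of_le_of_lt ((enum I).monotone (Fin.le_last i)) h
  · rw [enum_topIndex]; rfl

/-- The last index of `I` is at least `n + 1`, while the earlier ones are no smaller than those of
`topIndex n`. So passing from the top product to that of `I` costs at least the factor `d (n+1) / d
n`; `nextIndex n` is a case of equality. -/
theorem indexProd_mul_le {n : ℕ} {d : Fin (2 * n + 2) → ℝ} (hd : ∀ i, 0 < d i)
    (ha : Antitone d) {I : MultiIndex (2 * n + 2) (n + 1)} (hI : I ≠ topIndex n) :
    indexProd d I * d ⟨n, by omega⟩ ≤ indexProd d (topIndex n) * d ⟨n + 1, by omega⟩ := by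
  rw [indexProd, indexProd, Fin.prod_univ_castSucc, Fin.prod_univ_castSucc, mul_assoc, mul_assoc,
    enum_topIndex (Fin.last n)]
  refine mul_le_mul (Finset.prod_le_prod (fun i _ => (hd _).le) fun i _ => ha ?_) ?_
    (mul_pos (hd _) (hd _)).le (Finset.prod_nonneg fun i _ => (hd _).le)
  · rw [enum_topIndex]
    exact le_enum I i.castSucc
  · rw [mul_comm]
    refine mul_le_mul (le_of_eq rfl) (ha ?_) (hd _).le (hd _).le
    exact lt_enum_last hI

theorem indexProd_nextIndex_mul {n : ℕ} (d : Fin (2 * n + 2) → ℝ) :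
    indexProd d (nextIndex n) * d ⟨n, by omega⟩ =
      indexProd d (topIndex n) * d ⟨n + 1, by omega⟩ := by
  rw [indexProd, indexProd, Fin.prod_univ_castSucc, Fin.prod_univ_castSucc]
  have h1 : ∀ i : Fin n, enum (nextIndex n) i.castSucc = enum (topIndex n) i.castSucc := by
    intro i
    rw [enum_nextIndex, enum_topIndex]
    ext
    simp
  have h2 : enum (nextIndex n) (Fin.last n) = ⟨n + 1, by omega⟩ := by
    rw [enum_nextIndex]; simp
  have h3 : enum (topIndex n) (Fin.last n) = ⟨n, by omega⟩ := by
    rw [enum_topIndex]; rfl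
  rw [h2, h3, Finset.prod_congr rfl fun i _ => by rw [h1 i]]
  ring

/-! ### Sequences of singular value decompositions -/

/-- A sequence of elements of `Γ` with distinct images under `ρ`, with singular value
decompositions. -/
structure IsCartanSeq {n : ℕ} (Γ : Subgroup PGL(Fin (2 * n + 2), ℂ))
    (a : ℕ → GL (Fin (2 * n + 2)) ℂ) (u : ℕ → Matrix (Fin (2 * n + 2)) (Fin (2 * n + 2)) ℂ)
    (d : ℕ → Fin (2 * n + 2) → ℝ) (v : ℕ → Matrix (Fin (2 * n + 2)) (Fin (2 * n + 2)) ℂ) :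
    Prop where
  cartan : ∀ ν, IsCartan (a ν) (u ν) (d ν) (v ν)
  mem : ∀ ν, ProjGenLinGroup.mk (a ν) ∈ Γ
  inj : Function.Injective fun ν => rho (2 * n + 2) (n + 1) (ProjGenLinGroup.mk (a ν))

/-- Convergence of the unitary factors, of the normalised singular values, and of their normalised
products. -/
structure IsCartanLimit {n : ℕ} (u : ℕ → Matrix (Fin (2 * n + 2)) (Fin (2 * n + 2)) ℂ)
    (d : ℕ → Fin (2 * n + 2) → ℝ) (v : ℕ → Matrix (Fin (2 * n + 2)) (Fin (2 * n + 2)) ℂ)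
    (U : Matrix (Fin (2 * n + 2)) (Fin (2 * n + 2)) ℂ) (e : Fin (2 * n + 2) → ℝ)
    (r : MultiIndex (2 * n + 2) (n + 1) → ℝ) (V : Matrix (Fin (2 * n + 2)) (Fin (2 * n + 2)) ℂ) :
    Prop where
  left : Tendsto u atTop (𝓝 U)
  right : Tendsto v atTop (𝓝 V)
  value : Tendsto (fun ν i => d ν i / d ν 0) atTop (𝓝 e)
  prod : Tendsto (fun ν I => indexProd (d ν) I / indexProd (d ν) (topIndex n)) atTop (𝓝 r)

section

variable {n : ℕ} {Γ : Subgroup PGL(Fin (2 * n + 2), ℂ)} {a : ℕ → GL (Fin (2 * n + 2)) ℂ}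
  {u v : ℕ → Matrix (Fin (2 * n + 2)) (Fin (2 * n + 2)) ℂ} {d : ℕ → Fin (2 * n + 2) → ℝ}
  {U V : Matrix (Fin (2 * n + 2)) (Fin (2 * n + 2)) ℂ} {e : Fin (2 * n + 2) → ℝ}
  {r : MultiIndex (2 * n + 2) (n + 1) → ℝ}

theorem IsCartanSeq.comp (h : IsCartanSeq Γ a u d v) {φ : ℕ → ℕ} (hφ : StrictMono φ) :
    IsCartanSeq Γ (a ∘ φ) (u ∘ φ) (d ∘ φ) (v ∘ φ) :=
  ⟨fun ν => h.cartan (φ ν), fun ν => h.mem (φ ν), fun _ _ hxy => hφ.injective (h.inj hxy)⟩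

/-- Everything moves in a compact set: two unitary groups, and quotients in `[0, 1]` because `d`
decreases. -/
theorem IsCartanSeq.exists_limit (h : IsCartanSeq Γ a u d v) :
    ∃ φ : ℕ → ℕ, StrictMono φ ∧ ∃ U e r V, IsCartanLimit (u ∘ φ) (d ∘ φ) (v ∘ φ) U e r V := by
  have hK := (isCompact_unitaryGroup (2 * n + 2)).prod <|
    (isCompact_unitaryGroup (2 * n + 2)).prod <|
    (isCompact_Icc (a := (0 : Fin (2 * n + 2) → ℝ)) (b := 1)).prod <|
    isCompact_Icc (a := (0 : MultiIndex (2 * n + 2) (n + 1) → ℝ)) (b := 1)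
  obtain ⟨⟨U, V, e, r⟩, -, φ, hφ, hlim⟩ := hK.tendsto_subseq
    (x := fun ν => (u ν, v ν, (fun i => d ν i / d ν 0),
      fun I => indexProd (d ν) I / indexProd (d ν) (topIndex n))) fun ν => by
    have hc := h.cartan ν
    have hp : ∀ I : MultiIndex (2 * n + 2) (n + 1), 0 < indexProd (d ν) I :=
      indexProd_pos hc.pos
    refine ⟨hc.left_mem, hc.right_mem, ⟨fun i => ?_, fun i => ?_⟩, fun I => ?_, fun I => ?_⟩
    · exact (div_pos (hc.pos i) (hc.pos 0)).le
    · exact (div_le_one (hc.pos 0)).2 (hc.anti (Fin.zero_le i))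
    · exact (div_pos (hp I) (hp _)).le
    · exact (div_le_one (hp _)).2 (indexProd_le hc.pos hc.anti I)
  refine ⟨φ, hφ, U, e, r, V, ?_, ?_, ?_, ?_⟩
  · exact (continuous_fst.tendsto _).comp hlim
  · exact ((continuous_fst.comp continuous_snd).tendsto _).comp hlim
  · exact ((continuous_fst.comp (continuous_snd.comp continuous_snd)).tendsto _).comp hlim
  · exact ((continuous_snd.comp (continuous_snd.comp continuous_snd)).tendsto _).comp hlim

theorem IsCartanSeq.left_mem (h : IsCartanSeq Γ a u d v) (hU : Tendsto u atTop (𝓝 U)) :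
    U ∈ unitaryGroup (Fin (2 * n + 2)) ℂ :=
  (isClosed_unitaryGroup _).mem_of_tendsto hU (Eventually.of_forall fun ν => (h.cartan ν).left_mem)

theorem IsCartanSeq.right_mem (h : IsCartanSeq Γ a u d v) (hV : Tendsto v atTop (𝓝 V)) :
    V ∈ unitaryGroup (Fin (2 * n + 2)) ℂ :=
  (isClosed_unitaryGroup _).mem_of_tendsto hV
    (Eventually.of_forall fun ν => (h.cartan ν).right_mem)

theorem smul_mul_diagonal_mul {ι : Type*} [Fintype ι] [DecidableEq ι] (c : ℂ) (A B : Matrix ι ι ℂ)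
    (x : ι → ℂ) : c • (A * diagonal x * B) = A * diagonal (fun i => c * x i) * B := by
  rw [← smul_mul_assoc, ← mul_smul_comm]
  congr 2
  ext i j
  by_cases h : i = j <;> simp [h]

theorem IsCartanLimit.tendsto_smul (h : IsCartanSeq Γ a u d v) (hl : IsCartanLimit u d v U e r V) :
    Tendsto (fun ν => ((d ν 0 : ℂ)⁻¹) • (a ν : Matrix (Fin (2 * n + 2)) (Fin (2 * n + 2)) ℂ))
      atTop (𝓝 (U * diagonal (fun i => (e i : ℂ)) * V)) := by
  have h1 : ∀ ν, ((d ν 0 : ℂ)⁻¹) • (a ν : Matrix (Fin (2 * n + 2)) (Fin (2 * n + 2)) ℂ) =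
      u ν * diagonal (fun i => ((d ν i / d ν 0 : ℝ) : ℂ)) * v ν := by
    intro ν
    rw [(h.cartan ν).eq, smul_mul_diagonal_mul]
    congr; ext i; push_cast; ring
  simp only [h1]
  have hc : Continuous fun x : Fin (2 * n + 2) → ℝ => diagonal (fun i => (x i : ℂ)) :=
    Continuous.matrix_diagonal (by fun_prop)
  exact (hl.left.mul ((hc.tendsto e).comp hl.value)).mul hl.right

theorem IsCartanLimit.tendsto_compound (h : IsCartanSeq Γ a u d v)
    (hl : IsCartanLimit u d v U e r V) :
    Tendsto (fun ν => ((indexProd (d ν) (topIndex n) : ℂ)⁻¹) •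
      ((Units.map (compoundHom (2 * n + 2) (n + 1)) (a ν) : GL _ ℂ) : Matrix _ _ ℂ)) atTop
      (𝓝 (compound (n + 1) U * diagonal (fun I => (r I : ℂ)) * compound (n + 1) V)) := by
  have h1 : ∀ ν, ((indexProd (d ν) (topIndex n) : ℂ)⁻¹) •
      ((Units.map (compoundHom (2 * n + 2) (n + 1)) (a ν) : GL _ ℂ) : Matrix _ _ ℂ) =
      compound (n + 1) (u ν) *
        diagonal (fun I => ((indexProd (d ν) I / indexProd (d ν) (topIndex n) : ℝ) : ℂ)) *
        compound (n + 1) (v ν) := by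
    intro ν
    rw [coe_map_compoundHom, (h.cartan ν).eq, compound_mul, compound_mul, compound_diagonal,
      smul_mul_diagonal_mul]
    congr; ext I
    have : ∏ i, (d ν (enum I i) : ℂ) = (indexProd (d ν) I : ℂ) := by simp [indexProd]
    rw [this]
    push_cast; ring
  simp only [h1]
  have hc : Continuous fun x : MultiIndex (2 * n + 2) (n + 1) → ℝ =>
      diagonal (fun i => (x i : ℂ)) := Continuous.matrix_diagonal (by fun_prop)
  have hcomp := continuous_compound (m := 2 * n + 2) (n + 1)
  exact (((hcomp.tendsto U).comp hl.left).mul ((hc.tendsto r).comp hl.prod)).mul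
    ((hcomp.tendsto V).comp hl.right)

theorem mul_diagonal_mul_ne_zero {ι : Type*} [Fintype ι] [DecidableEq ι] {A A' B B' : Matrix ι ι ℂ}
    (hA : A' * A = 1) (hB : B * B' = 1) {x : ι → ℂ} {i : ι} (hx : x i ≠ 0) :
    A * diagonal x * B ≠ 0 := by
  intro h
  have h1 : A' * (A * diagonal x * B) * B' = diagonal x := by
    rw [← mul_assoc, ← mul_assoc, hA, one_mul, mul_assoc, hB, mul_one]
  rw [h, mul_zero, zero_mul] at h1
  exact hx (by simpa using (congrFun (congrFun h1 i) i).symm)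

theorem compound_mul_compound_star {k m : ℕ} {W : Matrix (Fin m) (Fin m) ℂ}
    (hW : W ∈ unitaryGroup (Fin m) ℂ) :
    compound k W * compound k (star W) = 1 ∧ compound k (star W) * compound k W = 1 := by
  rw [← compound_mul, ← compound_mul, mem_unitaryGroup_iff.1 hW, mem_unitaryGroup_iff'.1 hW,
    compound_one]
  exact ⟨rfl, rfl⟩

theorem IsCartanLimit.apply_zero (h : IsCartanSeq Γ a u d v) (hl : IsCartanLimit u d v U e r V) :
    e 0 = 1 := by
  refine tendsto_nhds_unique (tendsto_pi_nhds.1 hl.value 0) ?_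
  simp only [div_self ((h.cartan _).pos 0).ne', tendsto_const_nhds]

theorem IsCartanLimit.apply_topIndex (h : IsCartanSeq Γ a u d v)
    (hl : IsCartanLimit u d v U e r V) : r (topIndex n) = 1 := by
  refine tendsto_nhds_unique (tendsto_pi_nhds.1 hl.prod (topIndex n)) ?_
  simp only [div_self (indexProd_pos (h.cartan _).pos _).ne', tendsto_const_nhds]

theorem IsCartanLimit.limit_ne_zero (h : IsCartanSeq Γ a u d v)
    (hl : IsCartanLimit u d v U e r V) : U * diagonal (fun i => (e i : ℂ)) * V ≠ 0 :=
  mul_diagonal_mul_ne_zero (mem_unitaryGroup_iff'.1 (h.left_mem hl.left))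
    (mem_unitaryGroup_iff.1 (h.right_mem hl.right)) (i := 0) (by simp [hl.apply_zero h])

theorem IsCartanLimit.limit_compound_ne_zero (h : IsCartanSeq Γ a u d v)
    (hl : IsCartanLimit u d v U e r V) :
    compound (n + 1) U * diagonal (fun I => (r I : ℂ)) * compound (n + 1) V ≠ 0 :=
  mul_diagonal_mul_ne_zero (compound_mul_compound_star (h.left_mem hl.left)).2
    (compound_mul_compound_star (h.right_mem hl.right)).1 (i := topIndex n)
    (by simp [hl.apply_topIndex h])

theorem IsCartanLimit.isNormalSeq (h : IsCartanSeq Γ a u d v) (hl : IsCartanLimit u d v U e r V) :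
    IsNormalSeq (fun ν => ProjGenLinGroup.mk (a ν)) ∧
      IsNormalSeq (fun ν => rho (2 * n + 2) (n + 1) (ProjGenLinGroup.mk (a ν))) := by
  refine ⟨⟨fun i j hij => h.inj (congrArg _ hij), _, isLimitMatrix_of_tendsto (fun _ => rfl)
    (fun ν => ?_) (fun ν => coe_GL_ne_zero _) (hl.limit_ne_zero h) (hl.tendsto_smul h)⟩,
    ⟨h.inj, _, isLimitMatrix_of_tendsto (fun ν => (rho_mk _ _).symm) (fun ν => ?_)
      (fun ν => coe_GL_ne_zero _) (hl.limit_compound_ne_zero h) (hl.tendsto_compound h)⟩⟩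
  · exact inv_ne_zero (by exact_mod_cast ((h.cartan ν).pos 0).ne')
  · exact inv_ne_zero (by exact_mod_cast (indexProd_pos (h.cartan ν).pos _).ne')

/-- `compound V` is invertible, so it does not affect the image of the limit. -/
theorem IsCartanLimit.mem_limitImage (h : IsCartanSeq Γ a u d v)
    (hl : IsCartanLimit u d v U e r V) {w : MultiIndex (2 * n + 2) (n + 1) → ℂ} (hw : w ≠ 0) :
    Projectivization.mk ℂ w hw ∈
        limitImage (fun ν => rho (2 * n + 2) (n + 1) (ProjGenLinGroup.mk (a ν))) ↔
      ∃ z : MultiIndex (2 * n + 2) (n + 1) → ℂ, compound (n + 1) U *ᵥ (fun I => r I * z I) = w := by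
  rw [mem_limitImage_iff (fun ν => (rho_mk _ _).symm)
    (fun ν => inv_ne_zero (by exact_mod_cast (indexProd_pos (h.cartan ν).pos _).ne'))
    (fun ν => coe_GL_ne_zero _) (hl.limit_compound_ne_zero h) (hl.tendsto_compound h)]
  have hV := compound_mul_compound_star (k := n + 1) (h.right_mem hl.right)
  have hd : ∀ z : MultiIndex (2 * n + 2) (n + 1) → ℂ,
      diagonal (fun I => (r I : ℂ)) *ᵥ z = fun I => r I * z I := fun z => by
    ext I; rw [mulVec_diagonal]
  constructor
  · rintro ⟨z, rfl⟩
    exact ⟨compound (n + 1) V *ᵥ z, by rw [← hd, mulVec_mulVec, mulVec_mulVec]⟩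
  · rintro ⟨z, rfl⟩
    refine ⟨compound (n + 1) (star V) *ᵥ z, ?_⟩
    rw [mulVec_mulVec, mul_assoc, hV.1, mul_one, ← hd, mulVec_mulVec]

theorem IsCartanLimit.isLimitPlane (h : IsCartanSeq Γ a u d v)
    (hl : IsCartanLimit u d v U e r V) {ℓ : NPlane n}
    (hℓ : ℓ.plucker ∈ limitImage (fun ν => rho (2 * n + 2) (n + 1) (ProjGenLinGroup.mk (a ν)))) :
    IsLimitPlane Γ ℓ :=
  ⟨_, h.mem, (hl.isNormalSeq h).1, (hl.isNormalSeq h).2, hℓ⟩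

/-- Passing to a subsequence keeps the limit matrix `S` of the representatives, so the plane stays
in the limit image. -/
theorem IsLimitPlane.exists_isCartanLimit {ℓ : NPlane n} (hℓ : IsLimitPlane Γ ℓ) :
    ∃ a u d v, IsCartanSeq Γ a u d v ∧ (∃ U e r V, IsCartanLimit u d v U e r V) ∧
      ℓ.plucker ∈ limitImage (fun ν => rho (2 * n + 2) (n + 1) (ProjGenLinGroup.mk (a ν))) := by
  obtain ⟨σ, hmem, -, hn, S, ⟨T, hT, hlim⟩, hS⟩ := hℓ
  choose a ha using fun ν => ProjGenLinGroup.mk_surjective (σ ν)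
  choose u d v hc using fun ν => exists_isCartan (a ν)
  have h : IsCartanSeq Γ a u d v :=
    ⟨hc, fun ν => by rw [ha]; exact hmem ν, by simpa only [ha] using hn.1⟩
  obtain ⟨φ, hφ, hl⟩ := h.exists_limit
  refine ⟨_, _, _, _, h.comp hφ, hl, S, ⟨T ∘ φ, fun ν => ?_, hlim.comp hφ.tendsto_atTop⟩, hS⟩
  have := hT (φ ν)
  simp only [← ha] at this
  exact this

end

/-! ### Gap between the middle singular values -/

theorem linearIndependent_of_pluckerVec_ne_zero {m k : ℕ} {x : Fin k → Fin m → ℂ}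
    (hx : pluckerVec x ≠ 0) : LinearIndependent ℂ x := by
  by_contra h
  apply hx
  ext K
  rw [pluckerVec_eq_repr, AlternatingMap.map_linearDependent _ _ h]
  simp

theorem pluckerVec_update {m k : ℕ} (x : Fin k → Fin m → ℂ) (i : Fin k) (α β : ℂ)
    (p q : Fin m → ℂ) :
    pluckerVec (Function.update x i (α • p + β • q)) =
      α • pluckerVec (Function.update x i p) + β • pluckerVec (Function.update x i q) := by
  ext K
  simp only [Pi.add_apply, Pi.smul_apply, pluckerVec_eq_repr, AlternatingMap.map_update_add,
    AlternatingMap.map_update_smul, map_add, map_smul, Finsupp.add_apply, Finsupp.smul_apply]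

/-- The vectors `e_0, …, e_{n - 1}, α e_n + β e_{n + 1}`. -/
noncomputable def pencilFrame (n : ℕ) (α β : ℂ) : Fin (n + 1) → Fin (2 * n + 2) → ℂ :=
  Function.update (fun i => Pi.single (enum (topIndex n) i) 1) (Fin.last n)
    (α • Pi.single ⟨n, by omega⟩ 1 + β • Pi.single ⟨n + 1, by omega⟩ 1)

theorem pluckerVec_pencilFrame (n : ℕ) (α β : ℂ) :
    pluckerVec (pencilFrame n α β) =
      α • Pi.single (topIndex n) 1 + β • Pi.single (nextIndex n) 1 := by
  rw [pencilFrame, pluckerVec_update, ← pluckerVec_single, ← pluckerVec_single]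
  congr 3
  · refine Function.update_eq_self_iff.2 ?_
    rw [enum_topIndex]; rfl
  · ext1 i
    by_cases hi : i = Fin.last n
    · subst hi
      rw [Function.update_self, enum_nextIndex]
      simp
    · rw [Function.update_of_ne hi, enum_nextIndex, enum_topIndex]
      have : (i : ℕ) < n := Fin.val_lt_last hi
      congr 1
      ext
      simp [this]

theorem topIndex_ne_nextIndex (n : ℕ) : topIndex n ≠ nextIndex n := by
  intro h
  have h1 := enum_topIndex (Fin.last n)
  rw [h, enum_nextIndex] at h1
  simpa using congrArg Fin.val h1

/-- Two subspaces of complementary excess dimension meet. -/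
theorem NPlane.exists_mem_mulVec_eq_zero {n : ℕ} (ℓ : NPlane n)
    (A : Matrix (Fin (2 * n + 2)) (Fin (2 * n + 2)) ℂ) :
    ∃ x ∈ ℓ.1, x ≠ 0 ∧ ∀ i : Fin (2 * n + 2), n + 1 < (i : ℕ) → (A *ᵥ x) i = 0 := by
  -- `T` reads off the last `n` coordinates of `A *ᵥ x`; since `ℓ.1` has dimension `n + 1`, it has a
  -- kernel.
  let f : Fin n → Fin (2 * n + 2) := fun j => ⟨n + 2 + j, by omega⟩
  let T : ℓ.1 →ₗ[ℂ] (Fin n → ℂ) := LinearMap.funLeft ℂ ℂ f ∘ₗ Matrix.toLin' A ∘ₗ ℓ.1.subtype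
  have hT : LinearMap.ker T ≠ ⊥ := LinearMap.ker_ne_bot_of_finrank_lt (by
    rw [ℓ.2, finrank_fin_fun]; omega)
  obtain ⟨x, hx, hx0⟩ := Submodule.exists_mem_ne_zero_of_ne_bot hT
  refine ⟨x, x.2, fun h => hx0 (Subtype.ext h), fun i hi => ?_⟩
  have h1 := congrFun (LinearMap.mem_ker.1 hx) ⟨i - (n + 2), by omega⟩
  have h2 : f ⟨i - (n + 2), by omega⟩ = i := Fin.ext (by simp only [f]; omega)
  change (A *ᵥ (x : Fin (2 * n + 2) → ℂ)) (f ⟨i - (n + 2), by omega⟩) = 0 at h1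
  rwa [h2] at h1

/-- Every vector supported on the indices up to `n + 1` lies in some member of the pencil: its two
middle coordinates determine `(α, β)`. The factor `c` may be zero, which covers the case where both
vanish. -/
theorem mem_span_pencilFrame {n : ℕ} {y : Fin (2 * n + 2) → ℂ} {α β c : ℂ}
    (hy : ∀ i : Fin (2 * n + 2), n + 1 < (i : ℕ) → y i = 0)
    (hα : y ⟨n, by omega⟩ = c * α) (hβ : y ⟨n + 1, by omega⟩ = c * β) :
    y ∈ Submodule.span ℂ (Set.range (pencilFrame n α β)) := by
  have h : y = ∑ i : Fin n, y (Fin.castLE (by omega) i) • pencilFrame n α β i.castSucc +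
      c • pencilFrame n α β (Fin.last n) := by
    have h1 : ∀ i : Fin n, pencilFrame n α β i.castSucc =
        Pi.single (Fin.castLE (by omega) i) 1 := fun i => by
      rw [pencilFrame, Function.update_of_ne (Fin.castSucc_ne_last i), enum_topIndex]
      rfl
    simp only [h1]
    rw [pencilFrame, Function.update_self]
    ext j
    simp only [Pi.add_apply, Finset.sum_apply, Pi.smul_apply, Pi.single_apply, smul_eq_mul,
      mul_ite, mul_one, mul_zero]
    by_cases hj : (j : ℕ) < n
    · rw [Finset.sum_eq_single ⟨j, hj⟩]
      · have h2 : j ≠ ⟨n, by omega⟩ := fun h => by simp [h] at hj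
        have h3 : j ≠ ⟨n + 1, by omega⟩ := fun h => by simp [h] at hj
        rw [if_neg h2, if_neg h3, if_pos (by ext; rfl)]
        simp
      · intro b _ hb
        rw [if_neg]
        rintro rfl
        exact hb rfl
      · simp
    · rw [Finset.sum_eq_zero fun i _ => by
        rw [if_neg]; rintro rfl; exact hj i.2, zero_add]
      rcases Nat.lt_trichotomy j (n + 1) with h2 | h2 | h2
      · have h3 : j = ⟨n, by omega⟩ := Fin.ext (by simp only; omega)
        rw [h3]
        simp [hα]
      · have h3 : j = ⟨n + 1, by omega⟩ := Fin.ext h2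
        rw [h3]
        simp [hβ]
      · have h3 : j ≠ ⟨n, by omega⟩ := fun h => by simp [h] at h2
        have h4 : j ≠ ⟨n + 1, by omega⟩ := fun h => by simp [h] at h2
        simp [h3, h4, hy j h2]
  rw [h]
  exact add_mem (sum_mem fun i _ => Submodule.smul_mem _ _ (Submodule.subset_span ⟨_, rfl⟩))
    (Submodule.smul_mem _ _ (Submodule.subset_span ⟨_, rfl⟩))

theorem mem_span_mulVec {m k : ℕ} {A B : Matrix (Fin m) (Fin m) ℂ} (hAB : A * B = 1)
    {x : Fin k → Fin m → ℂ} {v : Fin m → ℂ} (hv : B *ᵥ v ∈ Submodule.span ℂ (Set.range x)) :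
    v ∈ Submodule.span ℂ (Set.range fun i => A *ᵥ x i) := by
  have h := Submodule.mem_map_of_mem (f := Matrix.toLin' A) hv
  rw [Submodule.map_span, ← Set.range_comp, toLin'_apply, mulVec_mulVec, hAB, one_mulVec] at h
  exact h

/-- If `Ω(Γ)` contains an `n`-plane, then the limit images are points. -/
theorem IsCartanLimit.apply_nextIndex {n : ℕ} {Γ : Subgroup PGL(Fin (2 * n + 2), ℂ)}
    {a : ℕ → GL (Fin (2 * n + 2)) ℂ} {u v : ℕ → Matrix (Fin (2 * n + 2)) (Fin (2 * n + 2)) ℂ}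
    {d : ℕ → Fin (2 * n + 2) → ℝ} {U V : Matrix (Fin (2 * n + 2)) (Fin (2 * n + 2)) ℂ}
    {e : Fin (2 * n + 2) → ℝ} {r : MultiIndex (2 * n + 2) (n + 1) → ℝ}
    (h : IsCartanSeq Γ a u d v) (hl : IsCartanLimit u d v U e r V) {ℓ : NPlane n}
    (hℓ : ℓ.support ⊆ discontinuitySet Γ) : r (nextIndex n) = 0 := by
  by_contra hr
  have hU := h.left_mem hl.left
  -- This is the point where `ℓ` meets the `(n+1)`-plane swept out by the pencil.
  obtain ⟨x, hxℓ, hx0, hx⟩ := ℓ.exists_mem_mulVec_eq_zero (star U)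
  obtain ⟨α, β, c, hαβ, hα, hβ⟩ : ∃ α β c : ℂ, (α ≠ 0 ∨ β ≠ 0) ∧
      (star U *ᵥ x) ⟨n, by omega⟩ = c * α ∧ (star U *ᵥ x) ⟨n + 1, by omega⟩ = c * β := by
    by_cases h0 : (star U *ᵥ x) ⟨n, by omega⟩ ≠ 0 ∨ (star U *ᵥ x) ⟨n + 1, by omega⟩ ≠ 0
    · exact ⟨_, _, 1, h0, (one_mul _).symm, (one_mul _).symm⟩
    · push Not at h0
      exact ⟨1, 0, 0, Or.inl one_ne_zero, by rw [h0.1, zero_mul], by rw [h0.2, zero_mul]⟩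
  have hspan := mem_span_mulVec (mem_unitaryGroup_iff.1 hU) (mem_span_pencilFrame hx hα hβ)
  have hne : pluckerVec (pencilFrame n α β) ≠ 0 := by
    rw [pluckerVec_pencilFrame]
    intro h0
    rcases hαβ with h1 | h1
    · exact h1 (by simpa [topIndex_ne_nextIndex] using congrFun h0 (topIndex n))
    · exact h1 (by simpa [(topIndex_ne_nextIndex n).symm] using congrFun h0 (nextIndex n))
  have hne' : pluckerVec (fun i => U *ᵥ pencilFrame n α β i) ≠ 0 := by
    rw [pluckerVec_mulVec]
    intro h0
    have := congrArg (compound (n + 1) (star U) *ᵥ ·) h0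
    simp only [mulVec_mulVec, (compound_mul_compound_star hU).2, one_mulVec, mulVec_zero] at this
    exact hne this
  have hli := linearIndependent_of_pluckerVec_ne_zero hne'
  have hlim : IsLimitPlane Γ (NPlane.ofLinearIndependent hli) := by
    apply hl.isLimitPlane h
    rw [NPlane.plucker_ofLinearIndependent, hl.mem_limitImage h]
    -- The diagonal factor multiplies the two coordinates by `1` and `r (nextIndex n)`, hence the
    -- division of `β`.
    refine ⟨α • Pi.single (topIndex n) 1 + (β / r (nextIndex n)) • Pi.single (nextIndex n) 1, ?_⟩
    rw [pluckerVec_mulVec, pluckerVec_pencilFrame]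
    congr 1
    ext I
    have hrc : (r (nextIndex n) : ℂ) ≠ 0 := by exact_mod_cast hr
    by_cases h1 : I = topIndex n
    · subst h1
      simp [topIndex_ne_nextIndex, hl.apply_topIndex h]
    · by_cases h2 : I = nextIndex n
      · subst h2
        simp [h1, mul_div_cancel₀ _ hrc]
      · simp [h1, h2]
  exact hℓ ((ℓ.mk_mem_support hx0).2 hxℓ) (Set.mem_biUnion hlim
    ((NPlane.mk_mem_support _ hx0).2 hspan))

/-! ### Limit planes as spans of columns of unitary matrices -/

theorem pencilFrame_one_zero_apply_eq_zero {n : ℕ} (i : Fin (n + 1)) {j : Fin (2 * n + 2)}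
    (hj : n < (j : ℕ)) : pencilFrame n 1 0 i j = 0 := by
  rw [pencilFrame]
  by_cases hi : i = Fin.last n
  · subst hi
    have h3 : j ≠ ⟨n, by omega⟩ := fun h => by simp [h] at hj
    simp [h3]
  · rw [Function.update_of_ne hi, enum_topIndex, Pi.single_apply, if_neg]
    rintro rfl
    have h1 := i.2
    simp only [Fin.val_castLE] at hj
    omega

theorem linearIndependent_mulVec_pencilFrame {n : ℕ}
    {U : Matrix (Fin (2 * n + 2)) (Fin (2 * n + 2)) ℂ} (hU : U ∈ unitaryGroup (Fin (2 * n + 2)) ℂ) :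
    LinearIndependent ℂ fun i => U *ᵥ pencilFrame n 1 0 i := by
  apply linearIndependent_of_pluckerVec_ne_zero
  rw [pluckerVec_mulVec, pluckerVec_pencilFrame, one_smul, zero_smul, add_zero]
  intro h0
  have := congrArg (compound (n + 1) (star U) *ᵥ ·) h0
  simp only [mulVec_mulVec, (compound_mul_compound_star hU).2, one_mulVec, mulVec_zero] at this
  simpa using congrFun this (topIndex n)

/-- The `n`-plane spanned by the first `n + 1` columns of a unitary matrix. -/
noncomputable def framePlane {n : ℕ} {U : Matrix (Fin (2 * n + 2)) (Fin (2 * n + 2)) ℂ}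
    (hU : U ∈ unitaryGroup (Fin (2 * n + 2)) ℂ) : NPlane n :=
  NPlane.ofLinearIndependent (linearIndependent_mulVec_pencilFrame hU)

/-- Membership becomes a condition closed jointly in `U` and `w`, the form used for the closedness
of the limit set. -/
theorem mem_framePlane {n : ℕ} {U : Matrix (Fin (2 * n + 2)) (Fin (2 * n + 2)) ℂ}
    (hU : U ∈ unitaryGroup (Fin (2 * n + 2)) ℂ) {w : Fin (2 * n + 2) → ℂ} :
    w ∈ (framePlane hU).1 ↔ ∀ i : Fin (2 * n + 2), n < (i : ℕ) → (star U *ᵥ w) i = 0 := by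
  constructor
  · intro hw i hi
    have hw' : w ∈ Submodule.span ℂ (Set.range fun i => U *ᵥ pencilFrame n 1 0 i) := hw
    induction hw' using Submodule.span_induction with
    | mem x hx =>
      obtain ⟨j, rfl⟩ := hx
      rw [mulVec_mulVec, mem_unitaryGroup_iff'.1 hU, one_mulVec]
      exact pencilFrame_one_zero_apply_eq_zero j hi
    | zero => simp
    | add x y hx hy h1 h2 => rw [mulVec_add, Pi.add_apply, h1 hx, h2 hy, add_zero]
    | smul c x hx h => rw [mulVec_smul, Pi.smul_apply, h hx, smul_zero]
  · intro h
    refine mem_span_mulVec (mem_unitaryGroup_iff.1 hU) (mem_span_pencilFrame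
      (c := (star U *ᵥ w) ⟨n, by omega⟩) (fun i hi => h i (by omega)) (mul_one _).symm ?_)
    rw [mul_zero]
    exact h _ (Nat.lt_succ_self n)

section

variable {n : ℕ} {Γ : Subgroup PGL(Fin (2 * n + 2), ℂ)} {a : ℕ → GL (Fin (2 * n + 2)) ℂ}
  {u v : ℕ → Matrix (Fin (2 * n + 2)) (Fin (2 * n + 2)) ℂ} {d : ℕ → Fin (2 * n + 2) → ℝ}
  {U V : Matrix (Fin (2 * n + 2)) (Fin (2 * n + 2)) ℂ} {e : Fin (2 * n + 2) → ℝ}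
  {r : MultiIndex (2 * n + 2) (n + 1) → ℝ}

/-! ### Sequences with a gap and their limit planes -/

/-- The quotient of the two middle singular values tends to zero. -/
def HasGap {n : ℕ} (d : ℕ → Fin (2 * n + 2) → ℝ) : Prop :=
  Tendsto (fun ν => d ν ⟨n + 1, by omega⟩ / d ν ⟨n, by omega⟩) atTop (𝓝 0)

/-- The normalised product at `nextIndex n` is exactly the quotient of the middle singular values.
-/
theorem IsCartanLimit.hasGap (h : IsCartanSeq Γ a u d v) (hl : IsCartanLimit u d v U e r V)
    {ℓ : NPlane n} (hℓ : ℓ.support ⊆ discontinuitySet Γ) : HasGap d := by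
  have h1 := tendsto_pi_nhds.1 hl.prod (nextIndex n)
  rw [hl.apply_nextIndex h hℓ] at h1
  refine h1.congr fun ν => ?_
  have hp := (h.cartan ν).pos
  rw [div_eq_div_iff (indexProd_pos hp _).ne' (hp _).ne', indexProd_nextIndex_mul, mul_comm]

theorem IsCartanLimit.eq_single (h : IsCartanSeq Γ a u d v) (hl : IsCartanLimit u d v U e r V)
    (hd : HasGap d) : r = Pi.single (topIndex n) 1 := by
  ext I
  by_cases hI : I = topIndex n
  · rw [hI, hl.apply_topIndex h, Pi.single_eq_same]
  · rw [Pi.single_eq_of_ne hI]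
    refine tendsto_nhds_unique (tendsto_pi_nhds.1 hl.prod I) (squeeze_zero (fun ν => ?_)
      (fun ν => ?_) hd)
    · exact (div_pos (indexProd_pos (h.cartan ν).pos _) (indexProd_pos (h.cartan ν).pos _)).le
    · have hp := (h.cartan ν).pos
      rw [div_le_div_iff₀ (indexProd_pos hp _) (hp _), mul_comm (d ν _) (indexProd _ _)]
      exact indexProd_mul_le hp (h.cartan ν).anti hI

/-- With `r` supported at `topIndex n`, the limit has rank one and its image is the line of
`compound U *ᵥ e_top`; Plücker coordinates determine the plane. -/
theorem IsCartanLimit.plucker_mem_limitImage_iff (h : IsCartanSeq Γ a u d v)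
    (hl : IsCartanLimit u d v U e r V) (hd : HasGap d) {ℓ : NPlane n} :
    ℓ.plucker ∈ limitImage (fun ν => rho (2 * n + 2) (n + 1) (ProjGenLinGroup.mk (a ν))) ↔
      ℓ = framePlane (h.left_mem hl.left) := by
  have hr := hl.eq_single h hd
  have hP : pluckerVec (fun i => U *ᵥ pencilFrame n 1 0 i) =
      compound (n + 1) U *ᵥ Pi.single (topIndex n) 1 := by
    rw [pluckerVec_mulVec, pluckerVec_pencilFrame, one_smul, zero_smul, add_zero]
  have hz : ∀ z : MultiIndex (2 * n + 2) (n + 1) → ℂ,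
      (fun I => (r I : ℂ) * z I) = z (topIndex n) • Pi.single (topIndex n) 1 := by
    intro z
    ext I
    by_cases hI : I = topIndex n
    · subst hI; simp [hr]
    · simp [hr, hI]
  constructor
  · intro hm
    rw [NPlane.plucker, hl.mem_limitImage h] at hm
    obtain ⟨z, hzw⟩ := hm
    apply NPlane.plucker_injective
    rw [framePlane, NPlane.plucker_ofLinearIndependent, NPlane.plucker,
      Projectivization.mk_eq_mk_iff']
    refine ⟨z (topIndex n), ?_⟩
    rw [← hzw, hz, mulVec_smul, hP]
  · rintro rfl
    rw [framePlane, NPlane.plucker_ofLinearIndependent, hl.mem_limitImage h]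
    exact ⟨Pi.single (topIndex n) 1, by rw [hz, hP]; simp⟩

/-! ### The compact set of limit frames -/

/-- The limits of the left unitary factors along sequences in `Γ` with a gap. -/
def limitFrames {n : ℕ} (Γ : Subgroup PGL(Fin (2 * n + 2), ℂ)) :
    Set (Matrix (Fin (2 * n + 2)) (Fin (2 * n + 2)) ℂ) :=
  {U | ∀ ε : ℝ, 0 < ε → ∀ F : Finset PGL(MultiIndex (2 * n + 2) (n + 1), ℂ), U ∈ closure
    {u | ∃ a d v, IsCartan a u d v ∧ ProjGenLinGroup.mk a ∈ Γ ∧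
      rho (2 * n + 2) (n + 1) (ProjGenLinGroup.mk a) ∉ F ∧
      d ⟨n + 1, by omega⟩ / d ⟨n, by omega⟩ < ε}}

/-- An intersection of closures is closed, so no diagonal argument is needed here. The finite sets
`F` in the definition are what later allows a sequence with distinct images to be extracted. -/
theorem isClosed_limitFrames : IsClosed (limitFrames Γ) := by
  simp only [limitFrames, Set.ofPred_forall]
  exact isClosed_iInter fun _ => isClosed_iInter fun _ => isClosed_iInter fun _ => isClosed_closure

theorem limitFrames_subset :
    limitFrames Γ ⊆ (unitaryGroup (Fin (2 * n + 2)) ℂ : Set (Matrix _ _ ℂ)) := by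
  intro U hU
  refine closure_minimal ?_ (isClosed_unitaryGroup _) (hU 1 one_pos ∅)
  rintro u ⟨a, d, v, h, -⟩
  exact h.left_mem

theorem isCompact_limitFrames : IsCompact (limitFrames Γ) :=
  (isCompact_unitaryGroup _).of_isClosed_subset isClosed_limitFrames limitFrames_subset

theorem IsCartanSeq.mem_limitFrames (h : IsCartanSeq Γ a u d v) (hU : Tendsto u atTop (𝓝 U))
    (hd : HasGap d) : U ∈ limitFrames Γ := by
  intro ε hε F
  refine mem_closure_of_tendsto hU ?_
  have h1 := h.inj.tendsto_cofinite
  rw [Nat.cofinite_eq_atTop] at h1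
  filter_upwards [hd.eventually_lt_const hε,
    h1.eventually (F.finite_toSet.eventually_cofinite_notMem)] with ν h2 h3
  exact ⟨a ν, d ν, v ν, h.cartan ν, h.mem ν, h3, h2⟩

/-- The terms are chosen recursively, each avoiding the finitely many earlier images under `rho`.
The natural number carried along controls both the neighbourhood of `U` and the size of the gap, and
it strictly increases. -/
theorem exists_isCartanSeq_of_mem_limitFrames (hU : U ∈ limitFrames Γ) :
    ∃ a u d v, IsCartanSeq Γ a u d v ∧ Tendsto u atTop (𝓝 U) ∧ HasGap d := by
  classical
  obtain ⟨s, hs⟩ := (𝓝 U).exists_antitone_basis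
  obtain ⟨f, hP, hr⟩ := exists_seq_of_forall_finset_exists
    (α := ℕ × GL (Fin (2 * n + 2)) ℂ × Matrix (Fin (2 * n + 2)) (Fin (2 * n + 2)) ℂ ×
      (Fin (2 * n + 2) → ℝ) × Matrix (Fin (2 * n + 2)) (Fin (2 * n + 2)) ℂ)
    (fun x => IsCartan x.2.1 x.2.2.1 x.2.2.2.1 x.2.2.2.2 ∧ ProjGenLinGroup.mk x.2.1 ∈ Γ ∧
      x.2.2.1 ∈ s x.1 ∧
      x.2.2.2.1 ⟨n + 1, by omega⟩ / x.2.2.2.1 ⟨n, by omega⟩ < 1 / ((x.1 : ℝ) + 1))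
    (fun x y => x.1 < y.1 ∧ rho (2 * n + 2) (n + 1) (ProjGenLinGroup.mk x.2.1) ≠
      rho (2 * n + 2) (n + 1) (ProjGenLinGroup.mk y.2.1)) (by
    intro t _
    set N := t.sup (fun x => x.1) + 1
    obtain ⟨u, hus, a, d, v, hc, hm, hF, hd⟩ := mem_closure_iff_nhds.1
      (hU (1 / ((N : ℝ) + 1)) (by positivity)
        (t.image fun x => rho (2 * n + 2) (n + 1) (ProjGenLinGroup.mk x.2.1)))
      (s N) (hs.toHasBasis.mem_of_mem trivial)
    refine ⟨(N, a, u, d, v), ⟨hc, hm, hus, hd⟩, fun x hx => ⟨?_, fun h => ?_⟩⟩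
    · exact Nat.lt_succ_of_le (Finset.le_sup (f := fun x => x.1) hx)
    · exact hF (Finset.mem_image.2 ⟨x, hx, h⟩))
  have hmono : StrictMono fun j => (f j).1 := fun i j hij => (hr i j hij).1
  refine ⟨fun j => (f j).2.1, fun j => (f j).2.2.1, fun j => (f j).2.2.2.1,
    fun j => (f j).2.2.2.2, ⟨fun j => (hP j).1, fun j => (hP j).2.1, ?_⟩, ?_, ?_⟩
  · intro i j hij
    by_contra hne
    rcases lt_or_gt_of_ne hne with h | h
    · exact (hr i j h).2 hij
    · exact (hr j i h).2 hij.symm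
  · rw [hs.toHasBasis.tendsto_right_iff]
    intro i _
    filter_upwards [eventually_ge_atTop i] with j hj
    exact hs.antitone (hj.trans (hmono.le_apply)) (hP j).2.2.1
  · refine squeeze_zero (fun j => ?_) (fun j => (hP j).2.2.2.le)
      (tendsto_one_div_add_atTop_nhds_zero_nat.comp hmono.tendsto_atTop)
    exact (div_pos ((hP j).1.pos _) ((hP j).1.pos _)).le

/-- A limit plane comes from a sequence with a gap because `ℓ` avoids the limit set. Conversely, a
subsequence of any sequence with a gap and left factors tending to `U` has the plane of `U` as its
only limit plane. -/
theorem mk_mem_limitSet_iff {ℓ : NPlane n} (hℓ : ℓ.support ⊆ discontinuitySet Γ)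
    {w : Fin (2 * n + 2) → ℂ} (hw : w ≠ 0) :
    Projectivization.mk ℂ w hw ∈ limitSet Γ ↔
      ∃ U ∈ limitFrames Γ, ∀ i : Fin (2 * n + 2), n < (i : ℕ) → (star U *ᵥ w) i = 0 := by
  constructor
  · intro hx
    obtain ⟨ℓ', hℓ', hwℓ⟩ := Set.mem_iUnion₂.1 hx
    obtain ⟨a, u, d, v, h, ⟨U, e, r, V, hl⟩, hm⟩ := IsLimitPlane.exists_isCartanLimit hℓ'
    have hd := hl.hasGap h hℓ
    rw [hl.plucker_mem_limitImage_iff h hd] at hm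
    subst hm
    exact ⟨U, h.mem_limitFrames hl.left hd,
      (mem_framePlane _).1 ((NPlane.mk_mem_support _ hw).1 hwℓ)⟩
  · rintro ⟨U, hU, hz⟩
    obtain ⟨a, u, d, v, h, hu, hd⟩ := exists_isCartanSeq_of_mem_limitFrames hU
    obtain ⟨φ, hφ, U', e, r, V, hl⟩ := h.exists_limit
    obtain rfl := tendsto_nhds_unique hl.left (hu.comp hφ.tendsto_atTop)
    have h' := h.comp hφ
    have hd' : HasGap (d ∘ φ) := hd.comp hφ.tendsto_atTop
    refine Set.mem_biUnion (x := framePlane (h'.left_mem hl.left)) ?_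
      ((NPlane.mk_mem_support _ hw).2 ((mem_framePlane _).2 hz))
    exact hl.isLimitPlane h' ((hl.plucker_mem_limitImage_iff h' hd').2 rfl)

/-! ### Properties of the limit set -/

theorem isClosed_limitSet {ℓ : NPlane n} (hℓ : ℓ.support ⊆ discontinuitySet Γ) :
    IsClosed (limitSet Γ) := by
  rw [isClosed_coinduced]
  have hA : IsClosed {w : Fin (2 * n + 2) → ℂ | ∃ U ∈ limitFrames Γ,
      -- This cone is the projection of a closed set of pairs `(U, w)` along the compact factor
      -- `limitFrames Γ`, and such projections are closed maps.
      ∀ i : Fin (2 * n + 2), n < (i : ℕ) → (star U *ᵥ w) i = 0} := by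
    have : CompactSpace (limitFrames Γ) := isCompact_iff_compactSpace.1 isCompact_limitFrames
    have hc : IsClosed {p : limitFrames Γ × (Fin (2 * n + 2) → ℂ) |
        ∀ i : Fin (2 * n + 2), n < (i : ℕ) → (star p.1.1 *ᵥ p.2) i = 0} := by
      simp only [Set.ofPred_forall]
      refine isClosed_iInter fun i => isClosed_iInter fun _ => isClosed_eq ?_ continuous_const
      exact (continuous_apply i).comp
        (Continuous.matrix_mulVec (continuous_subtype_val.comp continuous_fst).star continuous_snd)
    convert isClosedMap_snd_of_compactSpace _ hc using 1
    ext w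
    simp
  convert hA.preimage (continuous_subtype_val (p := fun w : Fin (2 * n + 2) → ℂ => w ≠ 0)) using 1
  ext ⟨w, hw⟩
  exact mk_mem_limitSet_iff hℓ hw

/-! ### Invariance under the group -/

theorem IsLimitPlane.exists_map {ℓ : NPlane n} (hℓ : IsLimitPlane Γ ℓ)
    {g : GL (Fin (2 * n + 2)) ℂ} (hg : ProjGenLinGroup.mk g ∈ Γ) :
    ∃ ℓ' : NPlane n, IsLimitPlane Γ ℓ' ∧
      ∀ w ∈ ℓ.1, (g : Matrix (Fin (2 * n + 2)) (Fin (2 * n + 2)) ℂ) *ᵥ w ∈ ℓ'.1 := by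
  set G : Matrix (Fin (2 * n + 2)) (Fin (2 * n + 2)) ℂ :=
    (g : Matrix (Fin (2 * n + 2)) (Fin (2 * n + 2)) ℂ)
  have hG : ((g⁻¹ : GL (Fin (2 * n + 2)) ℂ) : Matrix (Fin (2 * n + 2)) (Fin (2 * n + 2)) ℂ) * G = 1 :=
    g.inv_mul
  have hli : LinearIndependent ℂ fun i => G *ᵥ (ℓ.basis i : Fin (2 * n + 2) → ℂ) :=
    (linearIndependent_coe ℓ.basis).map' (Matrix.toLin' G) <| LinearMap.ker_eq_bot.2 <|
      mulVec_injective_iff_isUnit.2 g.isUnit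
  refine ⟨NPlane.ofLinearIndependent hli, ?_, fun w hw => ?_⟩
  · obtain ⟨σ, hmem, hn, hn', hp⟩ := hℓ
    have hmul : (fun ν => rho (2 * n + 2) (n + 1) (ProjGenLinGroup.mk g * σ ν)) = fun ν =>
        ProjGenLinGroup.mk (Units.map (compoundHom (2 * n + 2) (n + 1)) g) *
          rho (2 * n + 2) (n + 1) (σ ν) := by
      ext ν
      rw [map_mul, rho_mk]
    refine ⟨fun ν => ProjGenLinGroup.mk g * σ ν, fun ν => Γ.mul_mem hg (hmem ν), hn.mul_left g,
      ?_, ?_⟩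
    · rw [hmul]
      exact hn'.mul_left _
    · rw [hmul, NPlane.plucker_ofLinearIndependent]
      exact mk_mulVec_mem_limitImage _ hp (pluckerVec_mulVec _ _)
  · refine mem_span_mulVec (A := G) (mul_eq_one_comm.1 hG) ?_
    rw [mulVec_mulVec, hG, one_mulVec, ℓ.span_basis]
    exact hw

theorem mk_smul_mk {g : GL (Fin (2 * n + 2)) ℂ} {w : Fin (2 * n + 2) → ℂ} (hw : w ≠ 0)
    (hgw : (g : Matrix (Fin (2 * n + 2)) (Fin (2 * n + 2)) ℂ) *ᵥ w ≠ 0) :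
    ProjGenLinGroup.mk g • (Projectivization.mk ℂ w hw : Proj n) =
      Projectivization.mk ℂ ((g : Matrix (Fin (2 * n + 2)) (Fin (2 * n + 2)) ℂ) *ᵥ w) hgw := rfl

theorem mulVec_ne_zero_of_GL {m : ℕ} (g : GL (Fin m) ℂ) {w : Fin m → ℂ} (hw : w ≠ 0) :
    (g : Matrix (Fin m) (Fin m) ℂ) *ᵥ w ≠ 0 := by
  intro h
  exact hw (mulVec_injective_iff_isUnit.2 g.isUnit (by rw [h, mulVec_zero]))

theorem smul_mem_limitSet {γ : PGL(Fin (2 * n + 2), ℂ)} (hγ : γ ∈ Γ) {x : Proj n}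
    (hx : x ∈ limitSet Γ) : γ • x ∈ limitSet Γ := by
  obtain ⟨g, rfl⟩ := ProjGenLinGroup.mk_surjective γ
  obtain ⟨ℓ, hℓ, hxℓ⟩ := Set.mem_iUnion₂.1 hx
  obtain ⟨ℓ', hℓ', hmap⟩ := IsLimitPlane.exists_map hℓ hγ
  induction x using Projectivization.ind with
  | h w hw =>
    rw [mk_smul_mk hw (mulVec_ne_zero_of_GL g hw)]
    exact Set.mem_biUnion hℓ' ((NPlane.mk_mem_support _ _).2
      (hmap w ((NPlane.mk_mem_support _ hw).1 hxℓ)))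

theorem image_smul_limitSet {γ : PGL(Fin (2 * n + 2), ℂ)} (hγ : γ ∈ Γ) :
    (fun x : Proj n => γ • x) '' limitSet Γ = limitSet Γ := by
  apply Set.Subset.antisymm
  · rintro _ ⟨x, hx, rfl⟩
    exact smul_mem_limitSet hγ hx
  · intro x hx
    exact ⟨γ⁻¹ • x, smul_mem_limitSet (Γ.inv_mem hγ) hx, smul_inv_smul γ x⟩

end

/-! ### Inverse sequences and empty interior -/

section

variable {n : ℕ} {Γ : Subgroup PGL(Fin (2 * n + 2), ℂ)} {a : ℕ → GL (Fin (2 * n + 2)) ℂ}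
  {u v : ℕ → Matrix (Fin (2 * n + 2)) (Fin (2 * n + 2)) ℂ} {d : ℕ → Fin (2 * n + 2) → ℝ}
  {U V : Matrix (Fin (2 * n + 2)) (Fin (2 * n + 2)) ℂ}

theorem IsCartanSeq.inv (h : IsCartanSeq Γ a u d v) :
    IsCartanSeq Γ (fun ν => (a ν)⁻¹) (fun ν => (star (v ν)).submatrix id Fin.rev)
      (fun ν i => (d ν i.rev)⁻¹) (fun ν => (star (u ν)).submatrix Fin.rev id) := by
  refine ⟨fun ν => (h.cartan ν).inv, fun ν => ?_, fun i j hij => h.inj ?_⟩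
  · rw [map_inv]
    exact Γ.inv_mem (h.mem ν)
  · simpa only [map_inv, _root_.inv_inj] using hij

/-- Reversal exchanges the indices `n` and `n + 1`, and inversion turns the quotient back. -/
theorem HasGap.inv (hd : HasGap d) : HasGap (fun ν i => (d ν i.rev)⁻¹) := by
  refine hd.congr fun ν => ?_
  have h1 : (⟨n + 1, by omega⟩ : Fin (2 * n + 2)).rev = ⟨n, by omega⟩ := by
    ext; simp only [Fin.val_rev]; omega
  have h2 : (⟨n, by omega⟩ : Fin (2 * n + 2)).rev = ⟨n + 1, by omega⟩ := by
    ext; simp only [Fin.val_rev]; omega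
  simp only [h1, h2]
  rw [inv_div_inv]

/-- The limit of the right unitary factors is injective on an `n`-plane in `Ω(Γ)`, up to
the coordinates with large indices. -/
theorem IsCartanSeq.eq_zero_of_mulVec_eq_zero (h : IsCartanSeq Γ a u d v) (hd : HasGap d)
    (hV : Tendsto v atTop (𝓝 V)) {ℓ : NPlane n} (hℓ : ℓ.support ⊆ discontinuitySet Γ)
    {y : Fin (2 * n + 2) → ℂ} (hy : y ∈ ℓ.1)
    (hVy : ∀ i : Fin (2 * n + 2), (i : ℕ) ≤ n → (V *ᵥ y) i = 0) : y = 0 := by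
  by_contra hy0
  -- The vectors killed by the first `n + 1` rows of `V` form the limit plane of the inverse
  -- sequence, so a nonzero `y` would be a point of the limit set on `ℓ`.
  refine hℓ ((ℓ.mk_mem_support hy0).2 hy) ((mk_mem_limitSet_iff hℓ hy0).2
    ⟨(star V).submatrix id Fin.rev, h.inv.mem_limitFrames ?_ hd.inv, fun i hi => ?_⟩)
  · have hc : Continuous fun W : Matrix (Fin (2 * n + 2)) (Fin (2 * n + 2)) ℂ =>
        (star W).submatrix id Fin.rev := continuous_star.matrix_submatrix _ _
    exact (hc.tendsto V).comp hV
  · have h1 : star ((star V).submatrix id Fin.rev) = V.submatrix Fin.rev id := by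
      ext i j; simp [Matrix.star_apply]
    rw [h1]
    refine hVy i.rev ?_
    rw [Fin.val_rev]
    omega

theorem div_le_gap {d : Fin (2 * n + 2) → ℝ} (hp : ∀ i, 0 < d i) (ha : Antitone d)
    {i l : Fin (2 * n + 2)} (hi : n < (i : ℕ)) (hl : (l : ℕ) ≤ n) :
    d i / d l ≤ d ⟨n + 1, by omega⟩ / d ⟨n, by omega⟩ :=
  div_le_div₀ (hp _).le (ha (Fin.mk_le_of_le_val hi)) (hp _) (ha (Fin.le_def.2 hl))

/-- Every vector of a limit `n`-plane is a limit of images of vectors of a given `n`-plane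
in `Ω(Γ)`. -/
theorem IsCartanSeq.exists_tendsto (h : IsCartanSeq Γ a u d v) (hd : HasGap d)
    (hU : Tendsto u atTop (𝓝 U)) (hV : Tendsto v atTop (𝓝 V))
    {ℓ : NPlane n} (hℓ : ℓ.support ⊆ discontinuitySet Γ) {w : Fin (2 * n + 2) → ℂ}
    (hw : ∀ i : Fin (2 * n + 2), n < (i : ℕ) → (star U *ᵥ w) i = 0) :
    ∃ x : ℕ → Fin (2 * n + 2) → ℂ, (∀ ν, x ν ∈ ℓ.1) ∧ Tendsto (fun ν =>
      (a ν : Matrix (Fin (2 * n + 2)) (Fin (2 * n + 2)) ℂ) *ᵥ x ν) atTop (𝓝 w) := by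
  set b : Fin (n + 1) → Fin (2 * n + 2) → ℂ := fun j => ℓ.basis j with hb
  set ι : Fin (n + 1) → Fin (2 * n + 2) := Fin.castLE (by omega) with hι
  set y : Fin (2 * n + 2) → ℂ := star U *ᵥ w with hy
  -- `M W` is the matrix, in the basis of `ℓ`, of `W` followed by projection to the first `n + 1`
  -- coordinates. At `W = V` it is invertible, hence also at `v ν` for large `ν`.
  let M : Matrix (Fin (2 * n + 2)) (Fin (2 * n + 2)) ℂ → Matrix (Fin (n + 1)) (Fin (n + 1)) ℂ :=
    fun W => of fun i j => (W *ᵥ b j) (ι i)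
  have hWb : ∀ j i, Continuous fun W : Matrix (Fin (2 * n + 2)) (Fin (2 * n + 2)) ℂ =>
      (W *ᵥ b j) i := fun j i =>
    (continuous_apply i).comp (Continuous.matrix_mulVec continuous_id continuous_const)
  have hMc : Continuous M := continuous_matrix fun i j => hWb j (ι i)
  have hsum : ∀ (W : Matrix (Fin (2 * n + 2)) (Fin (2 * n + 2)) ℂ) (t : Fin (n + 1) → ℂ)
      (i : Fin (2 * n + 2)), (W *ᵥ ∑ j, t j • b j) i = ∑ j, (W *ᵥ b j) i * t j := by
    intro W t i
    rw [mulVec_sum, Finset.sum_apply]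
    refine Finset.sum_congr rfl fun j _ => ?_
    rw [mulVec_smul, Pi.smul_apply, smul_eq_mul, mul_comm]
  have hbmem : ∀ t : Fin (n + 1) → ℂ, ∑ j, t j • b j ∈ ℓ.1 := fun t =>
    sum_mem fun j _ => Submodule.smul_mem _ _ (ℓ.basis j).2
  have hdet : (M V).det ≠ 0 := by
    intro h0
    obtain ⟨t, ht0, ht⟩ := exists_mulVec_eq_zero_iff.2 h0
    have h1 : ∑ j, t j • b j = 0 := by
      refine h.eq_zero_of_mulVec_eq_zero hd hV hℓ (hbmem t) fun i hi => ?_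
      rw [hsum]
      exact congrFun ht ⟨i, by omega⟩
    exact ht0 (funext (Fintype.linearIndependent_iff.1 (linearIndependent_coe ℓ.basis) t h1))
  have hMv : Tendsto (fun ν => M (v ν)) atTop (𝓝 (M V)) := (hMc.tendsto V).comp hV
  have hdetv : Tendsto (fun ν => (M (v ν)).det) atTop (𝓝 (M V).det) :=
    ((continuous_id.matrix_det).tendsto (M V)).comp hMv
  have hinv : Tendsto (fun ν => (M (v ν))⁻¹) atTop (𝓝 (M V)⁻¹) := by
    simp only [inv_def, Ring.inverse_eq_inv']
    exact (hdetv.inv₀ hdet).smul (((continuous_id.matrix_adjugate).tendsto (M V)).comp hMv)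
  -- The coefficients solve `M (v ν) *ᵥ t ν = s ν`, so that after multiplication by the singular
  -- values the first `n + 1` coordinates equal those of `y` as soon as `M (v ν)` is invertible.
  let s : ℕ → Fin (n + 1) → ℂ := fun ν l => y (ι l) / d ν (ι l)
  let t : ℕ → Fin (n + 1) → ℂ := fun ν => (M (v ν))⁻¹ *ᵥ s ν
  refine ⟨fun ν => ∑ j, t ν j • b j, fun ν => hbmem _, ?_⟩
  have hz : Tendsto (fun ν i => (d ν i : ℂ) * (v ν *ᵥ ∑ j, t ν j • b j) i) atTop (𝓝 y) := by
    rw [tendsto_pi_nhds]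
    intro i
    -- The remaining coordinates carry factors `d ν i / d ν l` with `l ≤ n < i`, which the gap
    -- forces to zero; the other factors converge.
    by_cases hi : n < (i : ℕ)
    · rw [hw i hi]
      have h1 : ∀ ν, (d ν i : ℂ) * (v ν *ᵥ ∑ j, t ν j • b j) i = ∑ j, ∑ l,
          (v ν *ᵥ b j) i * ((M (v ν))⁻¹ j l * y (ι l)) * ((d ν i / d ν (ι l) : ℝ) : ℂ) := by
        intro ν
        rw [hsum, Finset.mul_sum]
        refine Finset.sum_congr rfl fun j _ => ?_
        simp only [t, s, mulVec, dotProduct, Finset.mul_sum]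
        refine Finset.sum_congr rfl fun l _ => ?_
        push_cast
        ring
      simp only [h1]
      rw [show (0 : ℂ) = ∑ j : Fin (n + 1), ∑ l : Fin (n + 1),
        (V *ᵥ b j) i * ((M V)⁻¹ j l * y (ι l)) * ((0 : ℝ) : ℂ) by simp]
      refine tendsto_finsetSum _ fun j _ => tendsto_finsetSum _ fun l _ => ?_
      refine ((((hWb j i).tendsto V).comp hV).mul (Tendsto.mul_const _
        (((continuous_id.matrix_elem j l).tendsto _).comp hinv))).mul
        ((Complex.continuous_ofReal.tendsto 0).comp ?_)
      refine squeeze_zero (fun ν => ?_) (fun ν => ?_) hd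
      · exact (div_pos ((h.cartan ν).pos _) ((h.cartan ν).pos _)).le
      · exact div_le_gap (h.cartan ν).pos (h.cartan ν).anti hi (Nat.lt_succ_iff.1 l.2)
    · refine tendsto_const_nhds.congr' ?_
      filter_upwards [hdetv.eventually_ne hdet] with ν hν
      have h1 : (v ν *ᵥ ∑ j, t ν j • b j) i = s ν ⟨i, by omega⟩ := by
        rw [hsum]
        change (M (v ν) *ᵥ t ν) ⟨i, by omega⟩ = _
        simp only [t]
        rw [mulVec_mulVec, mul_nonsing_inv _ (isUnit_iff_ne_zero.2 hν), one_mulVec]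
      have h2 : (d ν i : ℂ) ≠ 0 := by exact_mod_cast ((h.cartan ν).pos i).ne'
      rw [h1]
      exact (mul_div_cancel₀ _ h2).symm
  have hlim := ((continuous_fst.matrix_mulVec continuous_snd).tendsto (U, y)).comp
    (hU.prodMk_nhds hz)
  have hUy : U *ᵥ y = w := by
    rw [hy, mulVec_mulVec, mem_unitaryGroup_iff.1 (h.left_mem hU), one_mulVec]
  rw [hUy] at hlim
  refine hlim.congr fun ν => ?_
  rw [(h.cartan ν).eq, ← mulVec_mulVec, ← mulVec_mulVec]
  simp only [Function.comp_apply]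
  congr 1
  ext i
  rw [mulVec_diagonal]

theorem interior_limitSet {ℓ : NPlane n} (hℓ : ℓ.support ⊆ discontinuitySet Γ) :
    interior (limitSet Γ) = ∅ := by
  rw [Set.eq_empty_iff_forall_notMem]
  intro x hx
  induction x using Projectivization.ind with
  | h w hw =>
  obtain ⟨U, hUΓ, hz⟩ := (mk_mem_limitSet_iff hℓ hw).1 (interior_subset hx)
  obtain ⟨a, u, d, v, h, hu, hd⟩ := exists_isCartanSeq_of_mem_limitFrames hUΓ
  obtain ⟨φ, hφ, U', e, r, V, hl⟩ := h.exists_limit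
  obtain rfl := tendsto_nhds_unique hl.left (hu.comp hφ.tendsto_atTop)
  have h' := h.comp hφ
  have hd' : HasGap (d ∘ φ) := hd.comp hφ.tendsto_atTop
  obtain ⟨y, hyℓ, hlim⟩ := h'.exists_tendsto hd' hl.left hl.right hℓ hz
  -- The interior is lifted to an open set of nonzero vectors, so that convergence in the vector
  -- space applies.
  have hO : IsOpen (Subtype.val '' (Projectivization.mk' ℂ ⁻¹' interior (limitSet Γ) :
      Set {w : Fin (2 * n + 2) → ℂ // w ≠ 0})) :=
    isOpen_ne.isOpenMap_subtype_val _ (isOpen_coinduced.1 isOpen_interior)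
  obtain ⟨ν, ⟨p, hp0⟩, hp, hpν⟩ := (hlim.eventually (hO.mem_nhds ⟨⟨w, hw⟩, hx, rfl⟩)).exists
  simp only at hpν
  have hy0 : y ν ≠ 0 := by
    intro h0
    rw [h0, mulVec_zero] at hpν
    exact hp0 hpν
  subst hpν
  have h1 : ProjGenLinGroup.mk ((a ∘ φ) ν) • (Projectivization.mk ℂ (y ν) hy0 : Proj n) ∈
      limitSet Γ := by
    rw [mk_smul_mk hy0 hp0]
    exact interior_subset hp
  -- Translating back by the inverse would put a point of `ℓ` into the limit set.
  have h2 := smul_mem_limitSet (Γ.inv_mem (h'.mem ν)) h1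
  rw [inv_smul_smul] at h2
  exact hℓ ((ℓ.mk_mem_support hy0).2 (hyℓ ν)) h2

end

end TypeL

theorem theorem3p5 (n : ℕ) (hn : 1 ≤ n) (Γ : Subgroup PGL(Fin (2 * n + 2), ℂ))
    (hΓ : TypeL.IsTypeL Γ) :
    IsClosed (TypeL.limitSet Γ) ∧ IsNowhereDense (TypeL.limitSet Γ) ∧
      ∀ γ ∈ Γ, (fun x : TypeL.Proj n => γ • x) '' TypeL.limitSet Γ = TypeL.limitSet Γ := by
  obtain ⟨-, D, ⟨-, -, ℓ, hℓD⟩, hD⟩ := hΓ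
  have hℓ := hℓD.trans hD
  have hcl := TypeL.isClosed_limitSet hℓ
  refine ⟨hcl, ?_, fun γ hγ => TypeL.image_smul_limitSet hγ⟩
  rw [hcl.isNowhereDense_iff]
  exact TypeL.interior_limitSet hℓ
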